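/- **Setting.** Let $X$ and $Y$ have state space $\{1,\dots,n\}$, let $p^Y$ be a probability distribution on $\{1,\dots,n\}$, let $\beta,\tau>0$, and for each $y$ let $\mathcal N_y$ be a symmetric set of pairs of distinct states of $X$ (the allowed transitions). A *feedback process* consists of nonnegative rates $R_t^{y}(x,x')$ for $0<t<\tau$ (from $(x',y)$ to $(x,y)$), which vanish for $(x',x)\notin\mathcal N_y$ and satisfy $R_t^{y}(x,x')>0\iff R_t^{y}(x',x)>0$, and an absolutely continuous nonnegative solution $p_t(x,y)$, $t\in[0,\tau]$, of the master equation $\dot p_t(x,y)=\sum_{x'}[R_t^{y}(x,x')p_t(x',y)-R_t^{y}(x',x)p_t(x,y)]$ (for almost every $t$) with $p_0(x,y)=\delta_{x,y}\,p^Y(y)$. Put $j_t^y(x,x')=R_t^y(x,x')p_t(x',y)$ and $J_t^y(x,x')=j_t^y(x,x')-j_t^y(x',x)$; the functions $j_t^y(x,x')$ and $j_t^y(x,x')\ln\frac{R_t^y(x,x')}{R_t^y(x',x)}$ (read as $0$ where the rates vanish) are assumed integrable on $[0,\tau]$. With $S$ the Shannon entropy and $p^X_t,p^Y_t$ the marginals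 of $p_t$, let $$\beta Q_\tau=-\int_0^\tau\sum_{x,x',y}j_t^y(x,x')\ln\frac{R_t^y(x,x')}{R_t^y(x',x)}\,dt,\qquad \Sigma_\tau^X=S(p_\tau^X)-S(p_0^X)-\beta Q_\tau,$$ $$I_t=S(p_t^X)+S(p_t^Y)-S(p_t),\quad \Delta I=I_\tau-I_0,\quad a_t=\sum_{y,\,x\ne x'}j_t^y(x,x'),\quad \langle a\rangle_\tau=\frac1\tau\int_0^\tau a_t\,dt .$$ Let $p_\downarrow$ be $p^Y$ rearranged in descending order. For $\mathcal E\in[0,1]$ let $\tilde p_{\mathcal E}=p_\downarrow$ if $p_\downarrow(1)\ge 1-\mathcal E$; otherwise let $M_{\mathcal E}$ be the largest $m\in\{2,\dots,n\}$ with $\frac{\mathcal E-\sum_{k>m}p_\downarrow(k)}{m-1}<p_\downarrow(m)$, and let $\tilde p_{\mathcal E}(1)=1-\mathcal E$, $\tilde p_{\mathcal E}(k)=\frac{\mathcal E-\sum_{l>M_{\mathcal E}}p_\downarrow(l)}{M_{\mathcal E}-1}$ for $2\le k\le M_{\mathcal E}$, and $\tilde p_{\mathcal E}(k)=p_\downarrow(k)$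 for $k>M_{\mathcal E}$. For $p,q$ with the same $Y$-marginal, a transport plan is a family $\pi_y(x,x')\ge0$ with $\sum_x\pi_y(x,x')=p(x',y)$ and $\sum_{x'}\pi_y(x,x')=q(x,y)$; $\mathcal W(p,q)$ is the minimum over plans of $\sum_{y,x,x'}d_y(x',x)\,\pi_y(x,x')$, where $d_y(x',x)\in\{0,1,\dots,\infty\}$ is the least number of transitions in $\mathcal N_y$ leading from $x'$ to $x$. Minimizing plans are called optimal. **Statement.** 1. The map $W\mapsto S(\tilde p_W)$ is a bijection from $[0,1-p_\downarrow(1)]$ onto $[0,S(p^Y)]$. Let $\mathcal W^{\min}_{p^Y}$ be its inverse. 2. For every feedback process, with $\mathcal W^{\min}=\mathcal W^{\min}_{p^Y}(|\Delta I|)$, one has $|\Delta I|\le S(p^Y)$, $0\le \mathcal W^{\min}/(\tau\langle a\rangle_\tau)<1$ (with $0/0=0$), and $$\Sigma_\tau^X\ \ge\ -|\Delta I|+2\,\mathcal W^{\min}\tanh^{-1}\!\frac{\mathcal W^{\min}}{\tau\langle a\rangle_\tau}.$$ 3. Assume (C): for every $y$ and every $x\neq y$ the direct transition from $(y,y)$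 to $(x,y)$ is allowed. Let $\sigma$ be any permutation ranking the states in descending order of $p^Y$ (so $\sigma(y)=k$ means that $p^Y(y)$ is the $k$-th largest value), let $I\in[0,S(p^Y)]$ and $W=\mathcal W^{\min}_{p^Y}(I)$. Let $p^*(x,y)=p^{*X}(x)\,p^{*}(y|x)$, where, if $W<1-p_\downarrow(1)$, $p^{*X}(x)=\frac{p^Y(x)-\tilde p_W(2)}{\tilde p_W(1)-\tilde p_W(2)}$ for $\sigma(x)\le M_W$ and $p^{*X}(x)=0$ otherwise, while if $W=1-p_\downarrow(1)$, $p^{*X}$ is the point mass at $\sigma^{-1}(1)$; and $p^*(y|x)=\tilde p_W(1)$ if $y=x$, $\tilde p_W(\sigma(x))$ if $y\ne x$ and $\sigma(y)=1$, and $\tilde p_W(\sigma(y))$ otherwise. Then: - $p^*$ is a probability distribution with $Y$-marginal $p^Y$, $\mathcal W(p_0,p^*)=W$, and a process that ends in $p^*$ has $|\Delta I|=I$. - Call a feedback process *constant along a plan* $\pi$, with current $J$ and activity $A$, if the net probability carried by each transition is $\int_0^\tau J_t^y(x,x')\,dt=\pi_y(x,x')-\pi_y(x',x)$ for $x\ne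 x'$, and for all $0<t<\tau$: $j_t^y(x,x')=0$ whenever $x\neq x'$ and $\pi_y(x,x')=\pi_y(x',x)=0$; the total current $\sum J_t^y(x,x')$ over all $(y,x,x')$ with $x\ne x'$ and $\pi_y(x,x')>0$ equals $J$; $a_t=A$; and the force $\ln\frac{j_t^y(x,x')}{j_t^y(x',x)}$ has one and the same value for all $t$ and all $(y,x,x')$ with $x\ne x'$, $\pi_y(x,x')>0$ and $j_t^y(x,x')+j_t^y(x',x)>0$. Every feedback process that ends in $p_\tau=p^*$ and is constant (for some $J,A$) along an optimal plan from $p_0$ to $p^*$ attains equality in 2. - If $I>0$ and $\tau A>W$, or if $I=0$ and $A=0$, there is a feedback process with $p_\tau=p^*$ that is constant along an optimal plan from $p_0$ to $p^*$ with current $J=W/\tau$ and activity $A$; it has $\langle a\rangle_\tau=A$ and $|\Delta I|=I$ and attains equality in 2. -/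

import Mathlib

open MeasureTheory Set

namespace Feedback

noncomputable section

/-! States of `X` and of `Y` are labelled by `Fin n`.  A joint distribution is a function
`p : Fin n → Fin n → ℝ`, with `p x y` the probability of `(x, y)`. -/

/-- Shannon entropy (natural logarithm, `0 ln 0 = 0`). -/
def shannon {ι : Type*} [Fintype ι] (p : ι → ℝ) : ℝ := ∑ i, Real.negMulLog (p i)

def marginalX {n : ℕ} (p : Fin n → Fin n → ℝ) (x : Fin n) : ℝ := ∑ y, p x y

def marginalY {n : ℕ} (p : Fin n → Fin n → ℝ) (y : Fin n) : ℝ := ∑ x, p x y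

def mutualInfo {n : ℕ} (p : Fin n → Fin n → ℝ) : ℝ :=
  shannon (marginalX p) + shannon (marginalY p) - shannon (fun z : Fin n × Fin n => p z.1 z.2)

/-- The error-free initial distribution `δ_{x,y} p^Y(y)`. -/
def initialDist {n : ℕ} (pY : Fin n → ℝ) (x y : Fin n) : ℝ := if x = y then pY y else 0

/-- A feedback process on the time interval `[0, τ]`.  The graph `N y` is the set of allowed
(bidirectional) transitions of `X` when the measurement result is `y`; the state of `Y` never
changes.  `rate t y x u` is the transition rate at time `t` from `(u, y)` to `(x, y)`, and
`prob t x y` the probability of `(x, y)` at time `t`.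

The master equation is required in integrated form, i.e. `prob` is absolutely continuous and
satisfies the differential equation at almost every time, so that protocols which are switched at
some instants, or whose rates are unbounded near the end points, are allowed.  The mean number
of jumps and the mean heat are required to be well defined (integrable). -/
structure FeedbackProcess {n : ℕ} (N : Fin n → SimpleGraph (Fin n)) (pY : Fin n → ℝ)
    (τ : ℝ) where
  rate : ℝ → Fin n → Fin n → Fin n → ℝ
  prob : ℝ → Fin n → Fin n → ℝ
  rate_nonneg : ∀ t ∈ Ioo 0 τ, ∀ y x u, 0 ≤ rate t y x u
  /-- Only allowed transitions occur. -/
  rate_eq_zero : ∀ t ∈ Ioo 0 τ, ∀ y x u, ¬ (N y).Adj u x → rate t y x u = 0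
  /-- The two rates of a transition vanish simultaneously, so that local detailed balance can hold. -/
  rate_pos_symm : ∀ t ∈ Ioo 0 τ, ∀ y x u, 0 < rate t y x u → 0 < rate t y u x
  prob_nonneg : ∀ t ∈ Icc 0 τ, ∀ x y, 0 ≤ prob t x y
  prob_zero : prob 0 = initialDist pY
  jump_integrable : ∀ y x u,
    IntervalIntegrable (fun t => rate t y x u * prob t u y) volume 0 τ
  /-- The master equation; since rates off `N y` vanish, the sum may run over all `u`. -/
  master : ∀ t ∈ Icc 0 τ, ∀ x y, prob t x y = prob 0 x y +
    ∫ s in (0 : ℝ)..t, ∑ u, (rate s y x u * prob s u y - rate s y u x * prob s x y)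
  heat_integrable : ∀ y x u, IntervalIntegrable
    (fun t => Real.log (rate t y x u / rate t y u x) * (rate t y x u * prob t u y)) volume 0 τ

namespace FeedbackProcess

variable {n : ℕ} {N : Fin n → SimpleGraph (Fin n)} {pY : Fin n → ℝ} {τ : ℝ}

/-- Probability of a transition `(u, y) → (x, y)` per unit time. -/
def jump (P : FeedbackProcess N pY τ) (t : ℝ) (y x u : Fin n) : ℝ :=
  P.rate t y x u * P.prob t u y

/-- Probability current from `(u, y)` to `(x, y)`. -/
def current (P : FeedbackProcess N pY τ) (t : ℝ) (y x u : Fin n) : ℝ :=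
  P.jump t y x u - P.jump t y u x

/-- Thermodynamic force of the transition `(u, y) → (x, y)`. -/
def force (P : FeedbackProcess N pY τ) (t : ℝ) (y x u : Fin n) : ℝ :=
  Real.log (P.jump t y x u / P.jump t y u x)

/-- Stochastic heat absorbed in a transition `(u, y) → (x, y)`, given by local detailed balance
`ln (R(x,u) / R(u,x)) = -β Q(x,u)`. -/
def stochasticHeat (P : FeedbackProcess N pY τ) (β t : ℝ) (y x u : Fin n) : ℝ :=
  -(1 / β) * Real.log (P.rate t y x u / P.rate t y u x)

/-- Mean heat absorbed by `X` during `[0, τ]`. -/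
def heat (P : FeedbackProcess N pY τ) (β : ℝ) : ℝ :=
  ∫ t in (0 : ℝ)..τ, ∑ y, ∑ x, ∑ u, P.stochasticHeat β t y x u * P.jump t y x u

/-- Entropy production `Σ_τ^X` of the subsystem `X`. -/
def entropyProduction (P : FeedbackProcess N pY τ) (β : ℝ) : ℝ :=
  shannon (marginalX (P.prob τ)) - shannon (marginalX (P.prob 0)) - β * P.heat β

/-- Change `ΔI` of the mutual information. -/
def infoChange (P : FeedbackProcess N pY τ) : ℝ :=
  mutualInfo (P.prob τ) - mutualInfo (P.prob 0)

/-- Activity `a_t`: expected number of jumps per unit time. -/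
def activity (P : FeedbackProcess N pY τ) (t : ℝ) : ℝ :=
  ∑ y, ∑ x, ∑ u, if x ≠ u then P.jump t y x u else 0

/-- Time-averaged activity `⟨a⟩_τ`. -/
def meanActivity (P : FeedbackProcess N pY τ) : ℝ :=
  (∫ t in (0 : ℝ)..τ, P.activity t) / τ

end FeedbackProcess

/-- `π y x u` is the probability transported from `(u, y)` to `(x, y)`. -/
structure IsTransportPlan {n : ℕ} (p q : Fin n → Fin n → ℝ) (π : Fin n → Fin n → Fin n → ℝ) :
    Prop where
  nonneg : ∀ y x u, 0 ≤ π y x u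
  source : ∀ y u, ∑ x, π y x u = p u y
  target : ∀ y x, ∑ u, π y x u = q x y

/-- Transport cost; the cost per unit probability is the minimal number of allowed transitions
(`⊤` if there is no path). -/
def transportCost {n : ℕ} (N : Fin n → SimpleGraph (Fin n)) (π : Fin n → Fin n → Fin n → ℝ) :
    ENNReal :=
  ∑ y, ∑ x, ∑ u, ((N y).edist u x : ENNReal) * ENNReal.ofReal (π y x u)

/-- The Wasserstein distance between joint distributions with the same `Y`-marginal. -/
def wasserstein {n : ℕ} (N : Fin n → SimpleGraph (Fin n)) (p q : Fin n → Fin n → ℝ) : ENNReal :=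
  ⨅ π ∈ {π | IsTransportPlan p q π}, transportCost N π

structure IsOptimalPlan {n : ℕ} (N : Fin n → SimpleGraph (Fin n)) (p q : Fin n → Fin n → ℝ)
    (π : Fin n → Fin n → Fin n → ℝ) : Prop where
  isPlan : IsTransportPlan p q π
  optimal : transportCost N π = wasserstein N p q

/-- The process carries the probability along the plan `π`, by direct transitions, at constant
total current `J` and constant activity `A`, with a force that is constant in time and the same
for all transitions in use. -/
structure IsConstantProtocol {n : ℕ} {N : Fin n → SimpleGraph (Fin n)} {pY : Fin n → ℝ} {τ : ℝ}
    (P : FeedbackProcess N pY τ) (π : Fin n → Fin n → Fin n → ℝ) (J A : ℝ) : Prop where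
  /-- The net probability carried by each transition is the one prescribed by the plan. -/
  transport : ∀ y x u, x ≠ u → ∫ t in (0 : ℝ)..τ, P.current t y x u = π y x u - π y u x
  /-- There is no traffic between states that the plan does not connect. -/
  off_plan : ∀ t ∈ Ioo 0 τ, ∀ y x u, x ≠ u → π y x u = 0 → π y u x = 0 → P.jump t y x u = 0
  /-- Total current along the plan. -/
  current_const : ∀ t ∈ Ioo 0 τ,
    (∑ y, ∑ x, ∑ u, if x ≠ u ∧ 0 < π y x u then P.current t y x u else 0) = J
  activity_const : ∀ t ∈ Ioo 0 τ, P.activity t = A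
  force_const : ∃ F : ℝ, ∀ t ∈ Ioo 0 τ, ∀ y x u, x ≠ u → 0 < π y x u →
    0 < P.jump t y x u + P.jump t y u x → P.force t y x u = F

/-! The distribution `p̃_E` of the achievable Fano inequality.  Ranks are elements of `Fin n`, so the
rank called `m` in `1, …, n` is the element of `Fin n` with value `m - 1`. -/

/-- `p` rearranged in descending order. -/
def sortDesc {n : ℕ} (p : Fin n → ℝ) (k : Fin n) : ℝ := p (Tuple.sort (fun i => -p i) k)

/-- The largest `m ∈ {2, …, n}` with `(E - ∑_{j > m} p↓(j)) / (m - 1) < p↓(m)`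
(only used when `p↓(1) < 1 - E`, and then it exists). -/
def cutoff {n : ℕ} (p : Fin n → ℝ) (E : ℝ) : ℕ :=
  (Finset.univ.filter (fun k : Fin n => 0 < k.val ∧
    (E - ∑ j, if k < j then sortDesc p j else 0) / (k.val : ℝ) < sortDesc p k)).sup
    (fun k => k.val + 1)

/-- `p̃_E`. -/
def fanoDist {n : ℕ} [NeZero n] (p : Fin n → ℝ) (E : ℝ) (k : Fin n) : ℝ :=
  if 1 - E ≤ sortDesc p 0 then sortDesc p k
  else if k = 0 then 1 - E
  else if k.val + 1 ≤ cutoff p E then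
    (E - ∑ j : Fin n, if cutoff p E < j.val + 1 then sortDesc p j else 0) / ((cutoff p E : ℝ) - 1)
  else sortDesc p k

/-- `W^min_p`, the inverse of `W ↦ S(p̃_W)` on `[0, 1 - p↓(1)]`. -/
def minWasserstein {n : ℕ} [NeZero n] (p : Fin n → ℝ) : ℝ → ℝ :=
  Function.invFunOn (fun W => shannon (fanoDist p W)) (Icc 0 (1 - sortDesc p 0))

/-- The `X`-marginal of the optimal final distribution; `σ y` is the rank of `y` in a descending
ordering of `p`.  At the end point `W = 1 - p↓(1)` it is the point mass at the first state. -/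
def optimalX {n : ℕ} [NeZero n] (p : Fin n → ℝ) (σ : Equiv.Perm (Fin n)) (W : ℝ) (x : Fin n) : ℝ :=
  if 1 - W ≤ sortDesc p 0 then (if σ x = 0 then 1 else 0)
  else if (σ x).val + 1 ≤ cutoff p W then
    (p x - fanoDist p W 1) / (fanoDist p W 0 - fanoDist p W 1)
  else 0

/-- The conditional distribution of `Y` given `x` of the optimal final distribution: `p̃_W`
rearranged in the order of `p`, with the values at `x` and at the first state swapped. -/
def optimalCond {n : ℕ} [NeZero n] (p : Fin n → ℝ) (σ : Equiv.Perm (Fin n)) (W : ℝ)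
    (x y : Fin n) : ℝ :=
  if y = x then fanoDist p W 0
  else if σ y = 0 then fanoDist p W (σ x)
  else fanoDist p W (σ y)

/-- The optimal final distribution. -/
def optimalFinal {n : ℕ} [NeZero n] (p : Fin n → ℝ) (σ : Equiv.Perm (Fin n)) (W : ℝ)
    (x y : Fin n) : ℝ :=
  optimalX p σ W x * optimalCond p σ W x y

/-- The right-hand side `-I + 2 W artanh (W / (τ a))`, `W = W^min_p(I)`, of the speed limit. -/
def activityBound {n : ℕ} [NeZero n] (p : Fin n → ℝ) (τ a I : ℝ) : ℝ :=
  -I + 2 * minWasserstein p I * Real.artanh (minWasserstein p I / (τ * a))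

end

end Feedback

namespace Feedback

noncomputable section

open Filter Topology

/-! ### Absolutely continuous functions -/

/-! Since `Y` never changes, `Σ^X` equals the total entropy production of the pair plus `ΔI`, and
since the start is error-free, `ΔI = -H(Y|X)` at the final time. Two independent inequalities then
suffice.

Thermodynamics: the total production is half the integrated sum of current times force, `(a - b) log
(a / b)` for the two jump frequencies `a`, `b` of a transition. This is jointly convex and
homogeneous in `(a - b, a + b)`, so it lies above its tangent planes, which are indexed by a force
`F` (`tangent_le_sub_mul_log_div`). Only the currents out of the states `(y, y)` are kept. They
integrate to the error probability `E = 1 - ∑ p_τ(y, y)`, and the sums `a + b` integrate to the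
number of jumps `T`. Optimizing over `F` gives `2 W artanh (W / T)` for every `0 ≤ W ≤ E`
(`speed_limit_of_forall_le`).

Information: the achievable Fano inequality says that `H(Y|X) = I` forces `E ≥ W^min(I)`
(`fano_inequality`). Permuting `Y` separately for each `x` preserves `H(Y|X)` and produces a law
dominated by `p^Y` off the most likely state, where it has mass at least `1 - E`. Among such laws
`p̃_E`, which is `p↓` cut off at a water level `θ`, has the largest entropy
(`shannon_le_shannon_waterFill`).

Equality: every row of `p^*` with positive weight is a permutation of `p̃_W` (`IsFillCoupling`), so
`H(Y|X) = S(p̃_W)` and `E = W`. A single constant force makes every tangent inequality an equality,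
and constant jump frequencies along the only transport plan realize it (`directProcess`).

The analytic difficulty is that probabilities may vanish, so that their logarithms are singular.
They are shifted by `ε > 0`, and `ε → 0` is taken by dominated convergence. -/

theorem _root_.LipschitzOnWith.comp_absolutelyContinuousOnInterval {f φ : ℝ → ℝ} {a b : ℝ}
    {s : Set ℝ} {K : NNReal} (hφ : LipschitzOnWith K φ s) (hf : AbsolutelyContinuousOnInterval f a b)
    (hs : MapsTo f (uIcc a b) s) : AbsolutelyContinuousOnInterval (φ ∘ f) a b := by
  rw [absolutelyContinuousOnInterval_iff] at hf ⊢
  intro ε hε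
  obtain ⟨δ, hδ, h⟩ := hf (ε / (K + 1)) (by positivity)
  refine ⟨δ, hδ, fun E hE hlt => ?_⟩
  have h1 := h E hE hlt
  rw [lt_div_iff₀ (by positivity), Finset.sum_mul] at h1
  refine lt_of_le_of_lt (Finset.sum_le_sum fun i hi => ?_) h1
  have hm := hE.1 i hi
  calc dist (φ (f (E.2 i).1)) (φ (f (E.2 i).2))
      ≤ K * dist (f (E.2 i).1) (f (E.2 i).2) := hφ.dist_le_mul _ (hs hm.1) _ (hs hm.2)
    _ ≤ dist (f (E.2 i).1) (f (E.2 i).2) * (K + 1) := by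
        nlinarith [dist_nonneg (x := f (E.2 i).1) (y := f (E.2 i).2)]

/-- The shift `ε` keeps the argument away from `0`, where `negMulLog` has infinite slope. On the
compact range that remains it is Lipschitz, so the composition is absolutely continuous and is the
integral of its derivative. -/
theorem integral_negMulLog_comp {f g : ℝ → ℝ} {τ c ε : ℝ} (hτ : 0 < τ) (hε : 0 < ε)
    (hf : IntervalIntegrable f volume 0 τ)
    (hg : ∀ t ∈ Icc 0 τ, g t = c + ∫ s in (0 : ℝ)..t, f s) (hg0 : ∀ t ∈ Icc 0 τ, 0 ≤ g t) :
    ∫ t in (0 : ℝ)..τ, (-Real.log (g t + ε) - 1) * f t =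
      Real.negMulLog (g τ + ε) - Real.negMulLog (g 0 + ε) := by
  set G : ℝ → ℝ := fun t => (c + ε) + ∫ s in (0 : ℝ)..t, f s with hG
  have hGg : ∀ t ∈ Icc 0 τ, G t = g t + ε := fun t ht => by rw [hG, hg t ht]; ring
  have hac : AbsolutelyContinuousOnInterval G 0 τ := by
    have h1 := hf.absolutelyContinuousOnInterval_intervalIntegral (c := 0) left_mem_uIcc
    have h2 : AbsolutelyContinuousOnInterval (fun _ : ℝ => c + ε) 0 τ :=
      (LipschitzOnWith.of_dist_le_mul (K := 0) (by simp)).absolutelyContinuousOnInterval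
    exact h2.add h1
  have hu : uIcc 0 τ = Icc 0 τ := uIcc_of_le hτ.le
  obtain ⟨B, hB⟩ := (isCompact_uIcc.image_of_continuousOn hac.continuousOn).bddAbove
  have hmaps : MapsTo G (uIcc 0 τ) (Icc ε B) := fun t ht =>
    ⟨by rw [hu] at ht; rw [hGg t ht]; linarith [hg0 t ht], hB ⟨t, ht, rfl⟩⟩
  have hcd : ContDiffOn ℝ 1 Real.negMulLog (Icc ε B) := by
    have : ContDiffOn ℝ 1 (fun x : ℝ => -x * Real.log x) (Icc ε B) :=
      contDiffOn_id.neg.mul (contDiffOn_id.log fun x hx => (hε.trans_le hx.1).ne')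
    exact this
  obtain ⟨K, hK⟩ := hcd.exists_lipschitzOnWith one_ne_zero (convex_Icc _ _) isCompact_Icc
  have hac2 := hK.comp_absolutelyContinuousOnInterval hac hmaps
  have h0 : (0 : ℝ) ∈ Icc 0 τ := ⟨le_rfl, hτ.le⟩
  have h1 : τ ∈ Icc 0 τ := ⟨hτ.le, le_rfl⟩
  rw [← hGg _ h0, ← hGg _ h1]
  have := hac2.integral_deriv_eq_sub
  simp only [Function.comp_apply] at this
  rw [← this]
  apply intervalIntegral.integral_congr_ae
  filter_upwards [hf.ae_hasDerivAt_integral] with t ht hmem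
  have hmem' : t ∈ Icc 0 τ := by rw [uIoc_of_le hτ.le] at hmem; exact Ioc_subset_Icc_self hmem
  have hd := (ht (by rwa [hu]) 0 left_mem_uIcc).const_add (c + ε)
  have hne : G t ≠ 0 := (hε.trans_le (hmaps (by rwa [hu])).1).ne'
  have := (Real.hasDerivAt_negMulLog hne).comp t hd
  rw [this.deriv, hGg t hmem']

/-- Where a nonnegative absolutely continuous function vanishes, its density vanishes. -/
theorem ae_eq_zero_of_primitive_eq_zero {f g : ℝ → ℝ} {τ c : ℝ}
    (hf : IntervalIntegrable f volume 0 τ)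
    (hg : ∀ t ∈ Icc 0 τ, g t = c + ∫ s in (0 : ℝ)..t, f s) (hg0 : ∀ t ∈ Icc 0 τ, 0 ≤ g t) :
    ∀ᵐ t, t ∈ Ioo 0 τ → g t = 0 → f t = 0 := by
  filter_upwards [hf.ae_hasDerivAt_integral] with t ht hmem h0
  have hτ : 0 ≤ τ := (hmem.1.trans hmem.2).le
  have hd := (ht (by rw [uIcc_of_le hτ]; exact Ioo_subset_Icc_self hmem) 0 left_mem_uIcc).const_add c
  -- An interior zero of a nonnegative function is a local minimum.
  refine IsLocalMin.hasDerivAt_eq_zero ?_ hd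
  filter_upwards [Ioo_mem_nhds hmem.1 hmem.2] with s hs
  rw [← hg t (Ioo_subset_Icc_self hmem), ← hg s (Ioo_subset_Icc_self hs), h0]
  exact hg0 s (Ioo_subset_Icc_self hs)

theorem sum_sum_eq_half_sum_add_swap {ι : Type*} [Fintype ι] (G : ι → ι → ℝ) :
    ∑ x, ∑ u, G x u = (1 / 2) * ∑ x, ∑ u, (G x u + G u x) := by
  have : ∑ x, ∑ u, G u x = ∑ x, ∑ u, G x u := Finset.sum_comm
  simp only [Finset.sum_add_distrib, this]
  ring

/-- Adding `ε` to both terms of a ratio moves it towards `1` without crossing. This monotonicity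
supplies the dominating functions for the limit `ε → 0`. -/
theorem log_add_sub_log_add_mem {a b ε : ℝ} (ha : 0 < a) (hb : 0 < b) (hε : 0 < ε) :
    Real.log (a + ε) - Real.log (b + ε) ∈ uIcc 0 (Real.log a - Real.log b) := by
  have key : ∀ {a b : ℝ}, 0 < a → a ≤ b → 0 ≤ Real.log (b + ε) - Real.log (a + ε) ∧
      Real.log (b + ε) - Real.log (a + ε) ≤ Real.log b - Real.log a := by
    intro a b ha hab
    have hb := ha.trans_le hab
    refine ⟨sub_nonneg.2 (Real.log_le_log (by positivity) (by linarith)), ?_⟩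
    rw [← Real.log_div (by positivity) (by positivity), ← Real.log_div hb.ne' ha.ne']
    apply Real.log_le_log (by positivity)
    rw [div_le_div_iff₀ (by positivity) ha]
    nlinarith
  rcases le_total a b with h | h
  · have := key ha h
    exact mem_uIcc.2 (Or.inr ⟨by linarith, by linarith⟩)
  · have := key hb h
    exact mem_uIcc.2 (Or.inl ⟨by linarith, by linarith⟩)

/-! ### Entropy balance of the pair `(X, Y)` -/

namespace FeedbackProcess

variable {n : ℕ} {N : Fin n → SimpleGraph (Fin n)} {pY : Fin n → ℝ} {τ : ℝ}

/-- Logarithm of the ratio of the two rates of a transition. -/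
def logRatio (P : FeedbackProcess N pY τ) (t : ℝ) (y x u : Fin n) : ℝ :=
  Real.log (P.rate t y x u / P.rate t y u x)

/-- Total entropy production of the composite system. -/
def totalProduction (P : FeedbackProcess N pY τ) : ℝ :=
  shannon (fun z : Fin n × Fin n => P.prob τ z.1 z.2) -
    shannon (fun z : Fin n × Fin n => P.prob 0 z.1 z.2) +
    ∫ t in (0 : ℝ)..τ, ∑ y, ∑ x, ∑ u, P.logRatio t y x u * P.jump t y x u

variable (P : FeedbackProcess N pY τ)

theorem logRatio_swap (t : ℝ) (y x u : Fin n) : P.logRatio t y u x = -P.logRatio t y x u := by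
  rw [logRatio, logRatio, ← Real.log_inv, inv_div]

theorem current_swap (t : ℝ) (y x u : Fin n) : P.current t y u x = -P.current t y x u := by
  simp [current]

theorem force_swap (t : ℝ) (y x u : Fin n) : P.force t y u x = -P.force t y x u := by
  rw [force, force, ← Real.log_inv, inv_div]

theorem jump_nonneg {t : ℝ} (ht : t ∈ Ioo 0 τ) (y x u : Fin n) : 0 ≤ P.jump t y x u :=
  mul_nonneg (P.rate_nonneg t ht y x u) (P.prob_nonneg t (Ioo_subset_Icc_self ht) u y)

theorem jump_self {t : ℝ} (ht : t ∈ Ioo 0 τ) (y x : Fin n) : P.jump t y x x = 0 := by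
  rw [jump, P.rate_eq_zero t ht y x x (SimpleGraph.irrefl _), zero_mul]

theorem intervalIntegrable_jump (y x u : Fin n) :
    IntervalIntegrable (fun t => P.jump t y x u) volume 0 τ := P.jump_integrable y x u

theorem intervalIntegrable_current (y x u : Fin n) :
    IntervalIntegrable (fun t => P.current t y x u) volume 0 τ :=
  (P.jump_integrable y x u).sub (P.jump_integrable y u x)

theorem intervalIntegrable_logRatio_mul_jump (y x u : Fin n) :
    IntervalIntegrable (fun t => P.logRatio t y x u * P.jump t y x u) volume 0 τ :=
  P.heat_integrable y x u

theorem intervalIntegrable_current_mul_logRatio (y x u : Fin n) :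
    IntervalIntegrable (fun t => P.current t y x u * P.logRatio t y x u) volume 0 τ := by
  refine ((P.heat_integrable y x u).add (P.heat_integrable y u x)).congr ?_
  intro t _
  have := P.logRatio_swap t y x u
  simp only [logRatio] at this
  simp only [current, jump, logRatio, this]
  ring

theorem intervalIntegrable_sum_current (y x : Fin n) :
    IntervalIntegrable (fun t => ∑ u, P.current t y x u) volume 0 τ := by
  have := IntervalIntegrable.sum (f := fun u t => P.current t y x u) Finset.univ
    fun u _ => P.intervalIntegrable_current y x u
  exact this.congr (fun t _ => by simp)

theorem prob_eq {t : ℝ} (ht : t ∈ Icc 0 τ) (x y : Fin n) :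
    P.prob t x y = P.prob 0 x y + ∫ s in (0 : ℝ)..t, ∑ u, P.current s y x u :=
  P.master t ht x y

theorem continuousOn_prob (hτ : 0 < τ) (x y : Fin n) :
    ContinuousOn (fun t => P.prob t x y) (uIcc 0 τ) := by
  have h := ((P.intervalIntegrable_sum_current
    y x).absolutelyContinuousOnInterval_intervalIntegral (c := 0) left_mem_uIcc).continuousOn
  refine (h.const_add (P.prob 0 x y)).congr fun t ht => ?_
  exact P.prob_eq (by rwa [uIcc_of_le hτ.le] at ht) x y

/-- At almost every time, jumps occur in one direction only if they occur in the other. -/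
theorem ae_jump_pos_symm : ∀ᵐ t, t ∈ Ioo 0 τ → ∀ y x u, 0 < P.jump t y x u →
    0 < P.rate t y x u ∧ 0 < P.rate t y u x ∧ 0 < P.prob t u y ∧ 0 < P.prob t x y := by
  have h : ∀ᵐ t, ∀ y x, t ∈ Ioo 0 τ → P.prob t x y = 0 → ∑ u, P.current t y x u = 0 := by
    rw [ae_all_iff]; intro y
    rw [ae_all_iff]; intro x
    exact ae_eq_zero_of_primitive_eq_zero (P.intervalIntegrable_sum_current y x)
      (fun t ht => P.prob_eq ht x y) fun t ht => P.prob_nonneg t ht x y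
  filter_upwards [h] with t ht hmem y x u hj
  have hR := (P.rate_nonneg t hmem y x u).lt_of_ne' (left_ne_zero_of_mul hj.ne')
  have hp := (P.prob_nonneg t (Ioo_subset_Icc_self hmem) u y).lt_of_ne' (right_ne_zero_of_mul hj.ne')
  refine ⟨hR, P.rate_pos_symm t hmem y x u hR, hp, ?_⟩
  refine (P.prob_nonneg t (Ioo_subset_Icc_self hmem) x y).lt_of_ne' fun h0 => ?_
  have h1 := ht y x hmem h0
  have h2 : ∀ v, P.current t y x v = P.jump t y x v := fun v => by simp [current, jump, h0]
  simp only [h2] at h1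
  rw [Finset.sum_eq_zero_iff_of_nonneg fun v _ => P.jump_nonneg hmem y x v] at h1
  exact hj.ne' (h1 u (Finset.mem_univ u))

/-- The force computed from the probabilities shifted by `ε`. -/
def shiftedForce (ε t : ℝ) (y x u : Fin n) : ℝ :=
  P.logRatio t y x u + (Real.log (P.prob t u y + ε) - Real.log (P.prob t x y + ε))

theorem intervalIntegrable_log_shift (hτ : 0 < τ) {ε : ℝ} (hε : 0 < ε) {f : ℝ → ℝ}
    (hf : IntervalIntegrable f volume 0 τ) (x y : Fin n) :
    IntervalIntegrable (fun t => f t * Real.log (P.prob t x y + ε)) volume 0 τ := by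
  refine hf.mul_continuousOn (ContinuousOn.log ((P.continuousOn_prob hτ x y).add_const ε) ?_)
  intro t ht
  rw [uIcc_of_le hτ.le] at ht
  have := P.prob_nonneg t ht x y
  positivity

theorem intervalIntegrable_current_mul_shiftedForce (hτ : 0 < τ) {ε : ℝ} (hε : 0 < ε)
    (y x u : Fin n) :
    IntervalIntegrable (fun t => P.current t y x u * P.shiftedForce ε t y x u) volume 0 τ := by
  have hJ := P.intervalIntegrable_current y x u
  refine ((P.intervalIntegrable_current_mul_logRatio y x u).add
    ((P.intervalIntegrable_log_shift hτ hε hJ u y).sub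
      (P.intervalIntegrable_log_shift hτ hε hJ x y))).congr (fun t _ => ?_)
  simp only [shiftedForce]
  ring

theorem shifted_entropy_balance (hτ : 0 < τ) {ε : ℝ} (hε : 0 < ε) :
    ∑ y, ∑ x, (Real.negMulLog (P.prob τ x y + ε) - Real.negMulLog (P.prob 0 x y + ε)) +
      ∫ t in (0 : ℝ)..τ, ∑ y, ∑ x, ∑ u, P.logRatio t y x u * P.jump t y x u =
    (1 / 2) * ∑ y, ∑ x, ∑ u, ∫ t in (0 : ℝ)..τ, P.current t y x u * P.shiftedForce ε t y x u := by
  have hi : ∀ y x u, IntervalIntegrable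
      (fun t => (-Real.log (P.prob t x y + ε) - 1) * P.current t y x u) volume 0 τ := by
    intro y x u
    have hJ := P.intervalIntegrable_current y x u
    refine ((P.intervalIntegrable_log_shift hτ hε hJ x y).neg.sub hJ).congr
      (fun t _ => ?_)
    simp only [Pi.neg_apply]
    ring
  have h1 : ∀ y x, Real.negMulLog (P.prob τ x y + ε) - Real.negMulLog (P.prob 0 x y + ε) =
      ∑ u, ∫ t in (0 : ℝ)..τ, (-Real.log (P.prob t x y + ε) - 1) * P.current t y x u := by
    intro y x
    rw [← intervalIntegral.integral_finsetSum fun u _ => hi y x u,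
      ← integral_negMulLog_comp hτ hε (P.intervalIntegrable_sum_current y x)
        (fun t ht => P.prob_eq ht x y) fun t ht => P.prob_nonneg t ht x y]
    simp only [Finset.mul_sum]
  have hL := P.intervalIntegrable_logRatio_mul_jump
  have hL1 : ∀ y x, IntervalIntegrable (fun t => ∑ u, P.logRatio t y x u * P.jump t y x u)
      volume 0 τ := fun y x => (IntervalIntegrable.sum Finset.univ fun u _ => hL y x u).congr
        (fun t _ => by simp)
  have hL2 : ∀ y, IntervalIntegrable (fun t => ∑ x, ∑ u, P.logRatio t y x u * P.jump t y x u)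
      volume 0 τ := fun y => (IntervalIntegrable.sum Finset.univ fun x _ => hL1 y x).congr
        (fun t _ => by simp)
  rw [intervalIntegral.integral_finsetSum fun y _ => hL2 y, ← Finset.sum_add_distrib,
    Finset.mul_sum]
  refine Finset.sum_congr rfl fun y _ => ?_
  rw [intervalIntegral.integral_finsetSum fun x _ => hL1 y x]
  simp only [h1, intervalIntegral.integral_finsetSum fun u (_ : u ∈ Finset.univ) => hL y _ u]
  simp only [← Finset.sum_add_distrib]
  -- Each transition is paired with its reverse: the current changes sign, so the constants `-1`
  -- cancel and the two logarithms combine into a difference.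
  rw [sum_sum_eq_half_sum_add_swap]
  congr 1
  refine Finset.sum_congr rfl fun x _ => Finset.sum_congr rfl fun u _ => ?_
  rw [← intervalIntegral.integral_add (hi y x u) (hL y x u),
    ← intervalIntegral.integral_add (hi y u x) (hL y u x),
    ← intervalIntegral.integral_add ((hi y x u).add (hL y x u)) ((hi y u x).add (hL y u x))]
  refine intervalIntegral.integral_congr fun t _ => ?_
  simp only [shiftedForce, P.logRatio_swap t y x u, P.current_swap t y x u]
  simp only [current]
  ring

/-- Where a current flows, almost always both rates and both probabilities are positive, so the
force is `logRatio` plus a difference of log-probabilities, and the shift only contracts that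
difference towards `0`. -/
theorem ae_current_mul_force : ∀ᵐ t, t ∈ Ioo 0 τ → ∀ y x u,
    0 ≤ P.current t y x u * P.force t y x u ∧
    Tendsto (fun ε => P.current t y x u * P.shiftedForce ε t y x u) (𝓝[>] 0)
      (𝓝 (P.current t y x u * P.force t y x u)) ∧
    ∀ ε > 0, P.current t y x u * P.shiftedForce ε t y x u ∈
      uIcc (P.current t y x u * P.logRatio t y x u) (P.current t y x u * P.force t y x u) := by
  filter_upwards [P.ae_jump_pos_symm] with t ht hmem y x u
  by_cases hJ : P.current t y x u = 0
  · simp [hJ]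
  have hpos : 0 < P.rate t y x u ∧ 0 < P.rate t y u x ∧ 0 < P.prob t u y ∧ 0 < P.prob t x y := by
    rcases (P.jump_nonneg hmem y x u).lt_or_eq with h | h
    · exact ht hmem y x u h
    rcases (P.jump_nonneg hmem y u x).lt_or_eq with h' | h'
    · obtain ⟨a, b, c, d⟩ := ht hmem y u x h'
      exact ⟨b, a, d, c⟩
    · exact absurd (by simp [current, ← h, ← h']) hJ
  obtain ⟨hR, hR', hu, hx⟩ := hpos
  have hforce : P.force t y x u =
      P.logRatio t y x u + (Real.log (P.prob t u y) - Real.log (P.prob t x y)) := by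
    rw [force, logRatio, jump, jump, Real.log_div (by positivity) (by positivity),
      Real.log_div (by positivity) (by positivity), Real.log_mul (by positivity) (by positivity),
      Real.log_mul (by positivity) (by positivity)]
    ring
  refine ⟨?_, ?_, fun ε hε => ?_⟩
  · have h1 : 0 < P.jump t y x u := mul_pos hR hu
    have h2 : 0 < P.jump t y u x := mul_pos hR' hx
    rw [force, Real.log_div h1.ne' h2.ne', current]
    rcases le_total (P.jump t y x u) (P.jump t y u x) with h | h
    · exact mul_nonneg_of_nonpos_of_nonpos (by linarith)
        (by linarith [Real.log_le_log h1 h])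
    · exact mul_nonneg (by linarith) (by linarith [Real.log_le_log h2 h])
  · rw [hforce]
    have : ∀ {a : ℝ}, 0 < a → Tendsto (fun ε => Real.log (a + ε)) (𝓝[>] 0) (𝓝 (Real.log a)) := by
      intro a ha
      have hc : ContinuousAt (fun ε => Real.log (a + ε)) 0 :=
        ContinuousAt.log (by fun_prop) (by simpa using ha.ne')
      simpa using hc.tendsto.mono_left nhdsWithin_le_nhds
    exact (((this hu).sub (this hx)).const_add _).const_mul _
  · rw [hforce, shiftedForce]
    have h := log_add_sub_log_add_mem hu hx hε
    rw [mul_add, mul_add]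
    have h2 : P.current t y x u * (Real.log (P.prob t u y + ε) - Real.log (P.prob t x y + ε)) ∈
        uIcc (P.current t y x u * 0)
          (P.current t y x u * (Real.log (P.prob t u y) - Real.log (P.prob t x y))) := by
      rw [← image_const_mul_uIcc]
      exact ⟨_, h, rfl⟩
    rw [mul_zero] at h2
    have h3 := image_const_add_uIcc (P.current t y x u * P.logRatio t y x u) 0
      (P.current t y x u * (Real.log (P.prob t u y) - Real.log (P.prob t x y)))
    rw [add_zero] at h3
    rw [← h3]
    exact ⟨_, h2, rfl⟩

/-- Through the balance equation the limit reduces to continuity of `negMulLog` at the two end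
times, so current times force need not be known to be integrable. -/
theorem tendsto_shifted_balance (hτ : 0 < τ) :
    Tendsto (fun ε => (1 / 2) * ∑ y, ∑ x, ∑ u,
      ∫ t in (0 : ℝ)..τ, P.current t y x u * P.shiftedForce ε t y x u) (𝓝[>] 0)
      (𝓝 P.totalProduction) := by
  have h : Tendsto (fun ε => ∑ y, ∑ x, (Real.negMulLog (P.prob τ x y + ε) -
      Real.negMulLog (P.prob 0 x y + ε)) +
      ∫ t in (0 : ℝ)..τ, ∑ y, ∑ x, ∑ u, P.logRatio t y x u * P.jump t y x u) (𝓝[>] 0)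
      (𝓝 P.totalProduction) := by
    have hc : Continuous fun ε => ∑ y, ∑ x, (Real.negMulLog (P.prob τ x y + ε) -
      Real.negMulLog (P.prob 0 x y + ε)) +
      ∫ t in (0 : ℝ)..τ, ∑ y, ∑ x, ∑ u, P.logRatio t y x u * P.jump t y x u := by fun_prop
    have := (hc.tendsto 0).mono_left (nhdsWithin_le_nhds (s := Ioi 0))
    convert this using 2
    simp only [totalProduction, shannon, Fintype.sum_prod_type, add_zero, Finset.sum_sub_distrib]
    rw [Finset.sum_comm, Finset.sum_comm (f := fun x y => Real.negMulLog (P.prob 0 x y))]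
  refine h.congr' ?_
  filter_upwards [self_mem_nhdsWithin] with ε hε
  exact P.shifted_entropy_balance hτ hε

theorem ae_restrict_of_Ioo {p : ℝ → Prop} (hτ : 0 < τ) (h : ∀ᵐ t, t ∈ Ioo 0 τ → p t) :
    ∀ᵐ t, t ∈ uIoc 0 τ → p t := by
  filter_upwards [h, Measure.ae_ne volume τ] with t h1 h2 hmem
  rw [uIoc_of_le hτ.le] at hmem
  exact h1 ⟨hmem.1, hmem.2.lt_of_ne h2⟩

/-- The total entropy production is the time integral of currents times forces. -/
theorem totalProduction_eq (hτ : 0 < τ)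
    (hi : ∀ y x u, IntervalIntegrable (fun t => P.current t y x u * P.force t y x u) volume 0 τ) :
    P.totalProduction =
      (1 / 2) * ∑ y, ∑ x, ∑ u, ∫ t in (0 : ℝ)..τ, P.current t y x u * P.force t y x u := by
  refine tendsto_nhds_unique (P.tendsto_shifted_balance hτ) (Tendsto.const_mul _ ?_)
  refine tendsto_finsetSum _ fun y _ => tendsto_finsetSum _ fun x _ =>
    tendsto_finsetSum _ fun u _ => ?_
  have hae := ae_restrict_of_Ioo hτ P.ae_current_mul_force
  refine intervalIntegral.tendsto_integral_filter_of_dominated_convergence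
    (fun t => |P.current t y x u * P.logRatio t y x u| + |P.current t y x u * P.force t y x u|)
    ?_ ?_ ((P.intervalIntegrable_current_mul_logRatio y x u).abs.add (hi y x u).abs) ?_
  · filter_upwards [self_mem_nhdsWithin] with ε hε
    exact (P.intervalIntegrable_current_mul_shiftedForce hτ hε
      y x u).aestronglyMeasurable_restrict_uIoc
  · filter_upwards [self_mem_nhdsWithin] with ε hε
    filter_upwards [hae] with t ht hmem
    have := (ht hmem y x u).2.2 ε hε
    rw [Real.norm_eq_abs, abs_le]
    rcases mem_uIcc.1 this with h | h <;> constructor <;>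
      cases abs_cases (P.current t y x u * P.logRatio t y x u) <;>
      cases abs_cases (P.current t y x u * P.force t y x u) <;> linarith
  · filter_upwards [hae] with t ht hmem
    exact (ht hmem y x u).2.1

/-- Lower bounds on current times force integrate to lower bounds on the entropy production. -/
theorem le_totalProduction (hτ : 0 < τ) (h : Fin n → Fin n → Fin n → ℝ → ℝ)
    (hi : ∀ y x u, IntervalIntegrable (h y x u) volume 0 τ)
    (hle : ∀ᵐ t, t ∈ Ioo 0 τ → ∀ y x u, h y x u t ≤ P.current t y x u * P.force t y x u) :
    (1 / 2) * ∑ y, ∑ x, ∑ u, ∫ t in (0 : ℝ)..τ, h y x u t ≤ P.totalProduction := by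
  have hae := ae_restrict_of_Ioo hτ P.ae_current_mul_force
  have hle' := ae_restrict_of_Ioo hτ hle
  -- Truncation at `h` replaces integrability of current times force. The minimum converges to `h`;
  -- it is at most `h`, and bounded below because the shifted product lies between `current *
  -- logRatio` and a nonnegative number.
  have hmin : ∀ ε > 0, ∀ y x u, IntervalIntegrable
      (fun t => min (P.current t y x u * P.shiftedForce ε t y x u) (h y x u t)) volume 0 τ := by
    intro ε hε y x u
    have h1 := P.intervalIntegrable_current_mul_shiftedForce hτ hε y x u
    rw [intervalIntegrable_iff] at h1 ⊢
    exact h1.inf (intervalIntegrable_iff.1 (hi y x u))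
  have hlim : Tendsto (fun ε => (1 / 2) * ∑ y, ∑ x, ∑ u, ∫ t in (0 : ℝ)..τ,
      min (P.current t y x u * P.shiftedForce ε t y x u) (h y x u t)) (𝓝[>] 0)
      (𝓝 ((1 / 2) * ∑ y, ∑ x, ∑ u, ∫ t in (0 : ℝ)..τ, h y x u t)) := by
    refine Tendsto.const_mul _ (tendsto_finsetSum _ fun y _ => tendsto_finsetSum _ fun x _ =>
      tendsto_finsetSum _ fun u _ => ?_)
    refine intervalIntegral.tendsto_integral_filter_of_dominated_convergence
      (fun t => |P.current t y x u * P.logRatio t y x u| + |h y x u t|)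
      ?_ ?_ ((P.intervalIntegrable_current_mul_logRatio y x u).abs.add (hi y x u).abs) ?_
    · filter_upwards [self_mem_nhdsWithin] with ε hε
      exact (hmin ε hε y x u).aestronglyMeasurable_restrict_uIoc
    · filter_upwards [self_mem_nhdsWithin] with ε hε
      filter_upwards [hae] with t ht hmem
      obtain ⟨h0, -, h1⟩ := ht hmem y x u
      have h1 := h1 ε hε
      rw [Real.norm_eq_abs, abs_le]
      have hlow : -|P.current t y x u * P.logRatio t y x u| ≤
          P.current t y x u * P.shiftedForce ε t y x u := by
        rcases mem_uIcc.1 h1 with h | h <;>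
          cases abs_cases (P.current t y x u * P.logRatio t y x u) <;> linarith
      constructor
      · refine le_min ?_ ?_
        · linarith [abs_nonneg (h y x u t)]
        · linarith [neg_abs_le (h y x u t), abs_nonneg (P.current t y x u * P.logRatio t y x u)]
      · exact (min_le_right _ _).trans ((le_abs_self _).trans (le_add_of_nonneg_left (abs_nonneg _)))
    · filter_upwards [hae, hle'] with t ht hl hmem
      have := (ht hmem y x u).2.1.min (tendsto_const_nhds (x := h y x u t))
      rwa [min_eq_right (hl hmem y x u)] at this
  refine le_of_tendsto_of_tendsto hlim (P.tendsto_shifted_balance hτ) ?_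
  filter_upwards [self_mem_nhdsWithin] with ε hε
  refine mul_le_mul_of_nonneg_left (Finset.sum_le_sum fun y _ => Finset.sum_le_sum fun x _ =>
    Finset.sum_le_sum fun u _ => ?_) (by norm_num)
  exact intervalIntegral.integral_mono hτ.le (hmin ε hε y x u)
    (P.intervalIntegrable_current_mul_shiftedForce hτ hε y x u) fun t => min_le_left _ _

end FeedbackProcess

/-! ### Tangent bounds and their optimization -/

theorem sum_sum_eq_zero_of_antisymm {ι : Type*} [Fintype ι] (G : ι → ι → ℝ)
    (h : ∀ x u, G u x = -G x u) : ∑ x, ∑ u, G x u = 0 := by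
  have h' : ∀ x u, G x u + G u x = 0 := fun x u => by rw [h]; ring
  rw [sum_sum_eq_half_sum_add_swap]
  simp [h']

/-- With `r = (a - b) / (a + b)` the right-hand side is `(a + b) * 2 r artanh r`; the left-hand side
is its tangent at `r = tanh (F / 2)`. The proof adds two instances of `1 - 1 / z ≤ log z`, one for
each direction of the transition. -/
theorem tangent_le_sub_mul_log_div {a b : ℝ} (ha : 0 < a) (hb : 0 < b) (F : ℝ) :
    (F + Real.sinh F) * (a - b) - (Real.cosh F - 1) * (a + b) ≤ (a - b) * Real.log (a / b) := by
  have key : ∀ {a b : ℝ} (F : ℝ), 0 < a → 0 < b →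
      a * F + a - b * Real.exp F ≤ a * Real.log (a / b) := by
    intro a b F ha hb
    have h := Real.one_sub_inv_le_log_of_pos
      (show 0 < a / b * Real.exp (-F) by positivity)
    rw [Real.log_mul (by positivity) (by positivity), Real.log_exp] at h
    have h2 := mul_le_mul_of_nonneg_left h ha.le
    have h3 : a * (1 - (a / b * Real.exp (-F))⁻¹) = a - b * Real.exp F := by
      rw [Real.exp_neg]; field_simp
    rw [h3] at h2
    linarith
  have h1 := key F ha hb
  have h2 := key (-F) hb ha
  rw [← inv_div, Real.log_inv] at h2
  rw [Real.sinh_eq, Real.cosh_eq]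
  linarith

/-- A Legendre transform in `F`. The supremum would be infinite for `0 < W` and `T ≤ W`, which is
why the ratio stays strictly below `1`. -/
theorem speed_limit_of_forall_le {E T W s : ℝ}
    (h : ∀ F, 0 ≤ F → (F + Real.sinh F) * E - (Real.cosh F - 1) * T ≤ s)
    (hW : 0 ≤ W) (hWE : W ≤ E) :
    W / T ∈ Ico 0 1 ∧ 2 * W * Real.artanh (W / T) ≤ s := by
  have h' : ∀ F, 0 ≤ F → (F + Real.sinh F) * W - (Real.cosh F - 1) * T ≤ s := by
    intro F hF
    refine le_trans ?_ (h F hF)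
    have : 0 ≤ F + Real.sinh F := add_nonneg hF (Real.sinh_nonneg_iff.2 hF)
    nlinarith
  rcases hW.eq_or_lt with rfl | hW0
  · have := h' 0 le_rfl
    simpa using this
  have hlt : W < T := by
    by_contra! hle
    have hs : ∀ F, 0 ≤ F → F * W ≤ s := by
      intro F hF
      refine le_trans ?_ (h' F hF)
      -- The hyperbolic terms contribute a nonnegative amount when `T ≤ W`, leaving a linear
      -- function of `F` that is unbounded.
      have h1 : Real.cosh F - 1 ≤ Real.sinh F := by
        have := Real.cosh_sub_sinh F
        have h2 : Real.exp (-F) ≤ 1 := Real.exp_le_one_iff.2 (by linarith)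
        linarith
      have h2 := Real.one_le_cosh F
      nlinarith
    have := hs ((|s| + 1) / W) (by positivity)
    rw [div_mul_cancel₀ _ hW0.ne'] at this
    linarith [le_abs_self s]
  have hT0 : 0 < T := hW0.trans hlt
  have hr0 : 0 ≤ W / T := by positivity
  have hr1 : W / T < 1 := (div_lt_one hT0).2 hlt
  refine ⟨⟨hr0, hr1⟩, ?_⟩
  set a := Real.artanh (W / T) with ha
  -- At the optimal force `F = 2 artanh (W / T)` the hyperbolic terms cancel and `F * W` remains.
  have h1 := h' (2 * a) (mul_nonneg zero_le_two (Real.artanh_nonneg hr0))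
  have h2 : Real.tanh a = W / T := Real.tanh_artanh ⟨by linarith, hr1⟩
  rw [Real.tanh_eq_sinh_div_cosh, div_eq_div_iff (Real.cosh_pos a).ne' hT0.ne'] at h2
  rw [Real.sinh_two_mul, Real.cosh_two_mul, Real.cosh_sq] at h1
  have h3 : (2 * Real.sinh a * Real.cosh a) * W = (2 * Real.sinh a ^ 2) * T := by
    linear_combination -2 * Real.sinh a * h2
  linarith

/-! ### Entropy production of `X`, activity, and outflow from the states `(y, y)` -/

namespace FeedbackProcess

variable {n : ℕ} {N : Fin n → SimpleGraph (Fin n)} {pY : Fin n → ℝ} {τ : ℝ}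

variable (P : FeedbackProcess N pY τ)

theorem marginalY_initialDist (pY : Fin n → ℝ) : marginalY (initialDist pY) = pY := by
  ext y; simp [marginalY, initialDist]

theorem marginalY_prob {t : ℝ} (ht : t ∈ Icc 0 τ) : marginalY (P.prob t) = pY := by
  conv_rhs => rw [← marginalY_initialDist pY, ← P.prob_zero]
  ext y
  simp only [marginalY]
  rw [Finset.sum_congr rfl fun x _ => P.prob_eq ht x y, Finset.sum_add_distrib, add_eq_left]
  have hsub : uIcc 0 t ⊆ uIcc 0 τ := by
    rw [uIcc_of_le ht.1, uIcc_of_le (ht.1.trans ht.2)]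
    exact Icc_subset_Icc_right ht.2
  rw [← intervalIntegral.integral_finsetSum fun x _ =>
    (P.intervalIntegrable_sum_current y x).mono_set hsub]
  simp [sum_sum_eq_zero_of_antisymm (fun x u => P.current _ y x u)
    fun x u => P.current_swap _ y x u]

/-- The law of `Y` is conserved, so `ΔI` is the entropy change of `X` minus that of the pair. -/
theorem entropyProduction_eq (hτ : 0 < τ) {β : ℝ} (hβ : 0 < β) :
    P.entropyProduction β = P.totalProduction + P.infoChange := by
  have hQ : β * P.heat β =
      -∫ t in (0 : ℝ)..τ, ∑ y, ∑ x, ∑ u, P.logRatio t y x u * P.jump t y x u := by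
    rw [heat, ← intervalIntegral.integral_const_mul, ← intervalIntegral.integral_neg]
    refine intervalIntegral.integral_congr fun t _ => ?_
    simp only [Finset.mul_sum, ← Finset.sum_neg_distrib]
    refine Finset.sum_congr rfl fun y _ => Finset.sum_congr rfl fun x _ =>
      Finset.sum_congr rfl fun u _ => ?_
    rw [stochasticHeat, logRatio]
    field_simp
  rw [entropyProduction, hQ, totalProduction, infoChange, mutualInfo, mutualInfo,
    P.marginalY_prob ⟨hτ.le, le_rfl⟩, P.marginalY_prob ⟨le_rfl, hτ.le⟩]
  ring

theorem activity_eq {t : ℝ} (ht : t ∈ Ioo 0 τ) :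
    P.activity t = ∑ y, ∑ x, ∑ u, P.jump t y x u := by
  rw [activity]
  refine Finset.sum_congr rfl fun y _ => Finset.sum_congr rfl fun x _ =>
    Finset.sum_congr rfl fun u _ => ?_
  split_ifs with h
  · rfl
  · rw [not_not.1 h, P.jump_self ht]

theorem integral_activity_eq (hτ : 0 < τ) : ∫ t in (0 : ℝ)..τ, P.activity t =
    ∑ y, ∑ x, ∑ u, ∫ t in (0 : ℝ)..τ, P.jump t y x u := by
  have hi := P.intervalIntegrable_jump
  have h1 : ∀ y x, IntervalIntegrable (fun t => ∑ u, P.jump t y x u) volume 0 τ := fun y x =>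
    (IntervalIntegrable.sum Finset.univ fun u _ => hi y x u).congr (fun t _ => by simp)
  have h2 : ∀ y, IntervalIntegrable (fun t => ∑ x, ∑ u, P.jump t y x u) volume 0 τ := fun y =>
    (IntervalIntegrable.sum Finset.univ fun x _ => h1 y x).congr (fun t _ => by simp)
  calc _ = ∫ t in (0 : ℝ)..τ, ∑ y, ∑ x, ∑ u, P.jump t y x u :=
        intervalIntegral.integral_congr_ae
          (ae_restrict_of_Ioo hτ (ae_of_all _ fun t ht => P.activity_eq ht))
    _ = _ := by
        rw [intervalIntegral.integral_finsetSum fun y _ => h2 y]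
        refine Finset.sum_congr rfl fun y _ => ?_
        rw [intervalIntegral.integral_finsetSum fun x _ => h1 y x]
        exact Finset.sum_congr rfl fun x _ =>
          intervalIntegral.integral_finsetSum fun u _ => hi y x u

/-- The probability of `x ≠ y` at the final time has left the states `(y, y)`. -/
theorem error_eq_outflow (hτ : 0 < τ) (hsum : ∑ y, pY y = 1) :
    1 - ∑ y, P.prob τ y y = ∑ y, ∑ u, ∫ t in (0 : ℝ)..τ, P.current t y u y := by
  have h0 : ∑ y, P.prob 0 y y = 1 := by rw [P.prob_zero]; simpa [initialDist] using hsum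
  rw [← h0, ← Finset.sum_sub_distrib]
  refine Finset.sum_congr rfl fun y _ => ?_
  rw [P.prob_eq ⟨hτ.le, le_rfl⟩ y y,
    intervalIntegral.integral_finsetSum fun u _ => P.intervalIntegrable_current y y u]
  simp_rw [fun t u => P.current_swap t y y u, intervalIntegral.integral_neg]
  simp

/-- `1` for transitions out of `(y, y)`, `-1` for transitions into `(y, y)`, and `0` otherwise. -/
def outSign (y x u : Fin n) : ℝ := (if u = y then 1 else 0) - (if x = y then 1 else 0)

/-- The factor `2` arises because each transition at `(y, y)` is met in both directions, with
opposite signs and opposite currents. -/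
theorem sum_outSign_mul_integral_current (y : Fin n) :
    ∑ x, ∑ u, outSign y x u * ∫ t in (0 : ℝ)..τ, P.current t y x u =
      2 * ∑ u, ∫ t in (0 : ℝ)..τ, P.current t y u y := by
  simp only [outSign, sub_mul, Finset.sum_sub_distrib, ite_mul, one_mul, zero_mul,
    Finset.sum_ite_eq', Finset.mem_univ, if_true]
  rw [Finset.sum_comm (f := fun x u => if x = y then
    ∫ t in (0 : ℝ)..τ, P.current t y x u else 0)]
  simp only [Finset.sum_ite_eq', Finset.mem_univ, if_true]
  simp_rw [fun t u => P.current_swap t y u y, intervalIntegral.integral_neg]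
  rw [Finset.sum_neg_distrib]
  ring

theorem tangent_le_totalProduction (hτ : 0 < τ) (hsum : ∑ y, pY y = 1) (F : ℝ) :
    (F + Real.sinh F) * (1 - ∑ y, P.prob τ y y) -
      (Real.cosh F - 1) * ∫ t in (0 : ℝ)..τ, P.activity t ≤ P.totalProduction := by
  set c : Fin n → Fin n → Fin n → ℝ := outSign with hc
  have hJ := P.intervalIntegrable_current
  have hj := P.intervalIntegrable_jump
  have hle := P.le_totalProduction hτ
    (fun y x u t => (F + Real.sinh F) * (c y x u * P.current t y x u) -
      (Real.cosh F - 1) * (P.jump t y x u + P.jump t y u x))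
    (fun y x u => (((hJ y x u).const_mul _).const_mul _).sub
      (((hj y x u).add (hj y u x)).const_mul _)) (by
      filter_upwards [P.ae_jump_pos_symm] with t ht hmem y x u
      have hsymm : 0 < P.jump t y x u ↔ 0 < P.jump t y u x := by
        constructor <;> intro h <;> obtain ⟨h1, h2, h3, h4⟩ := ht hmem _ _ _ h
        exacts [mul_pos h2 h4, mul_pos h2 h4]
      rcases (P.jump_nonneg hmem y x u).lt_or_eq with h | h
      · have h' := hsymm.1 h
        have hcosh := Real.one_le_cosh F
        have key := fun G => tangent_le_sub_mul_log_div h h' G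
        -- The tangent is taken at `F`, `-F` or `0` according to `outSign`; at `0` it only says that
        -- the product is nonnegative.
        have h0 := key 0
        have hp := key F
        have hm := key (-F)
        simp only [Real.sinh_neg, Real.cosh_neg, Real.sinh_zero, Real.cosh_zero] at h0 hm
        rw [force, current]
        simp only [hc, outSign]
        split_ifs <;> nlinarith
      · have h' : P.jump t y u x = 0 := by
          rcases (P.jump_nonneg hmem y u x).lt_or_eq with h2 | h2
          · exact absurd (hsymm.2 h2) (by rw [← h]; exact lt_irrefl 0)
          · exact h2.symm
        simp [current, ← h, h'])
  refine le_trans (le_of_eq ?_) hle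
  rw [P.error_eq_outflow hτ hsum, P.integral_activity_eq hτ, Finset.mul_sum, Finset.mul_sum,
    ← Finset.sum_sub_distrib, Finset.mul_sum]
  refine Finset.sum_congr rfl fun y _ => ?_
  have hI : ∀ x u, ∫ t in (0 : ℝ)..τ, ((F + Real.sinh F) * (c y x u * P.current t y x u) -
      (Real.cosh F - 1) * (P.jump t y x u + P.jump t y u x)) =
      (F + Real.sinh F) * (c y x u * ∫ t in (0 : ℝ)..τ, P.current t y x u) -
      (Real.cosh F - 1) * ((∫ t in (0 : ℝ)..τ, P.jump t y x u) +
        ∫ t in (0 : ℝ)..τ, P.jump t y u x) := by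
    intro x u
    rw [intervalIntegral.integral_sub (((hJ y x u).const_mul _).const_mul _)
      (((hj y x u).add (hj y u x)).const_mul _), intervalIntegral.integral_const_mul,
      intervalIntegral.integral_const_mul, intervalIntegral.integral_const_mul,
      intervalIntegral.integral_add (hj y x u) (hj y u x)]
  simp only [hI, Finset.sum_sub_distrib, ← Finset.mul_sum]
  have h2 := sum_sum_eq_half_sum_add_swap (fun x u => ∫ t in (0 : ℝ)..τ, P.jump t y x u)
  rw [hc, P.sum_outSign_mul_integral_current, h2]
  ring

theorem speed_limit (hτ : 0 < τ) (hsum : ∑ y, pY y = 1) {W : ℝ} (hW : 0 ≤ W)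
    (hWE : W ≤ 1 - ∑ y, P.prob τ y y) :
    W / (τ * P.meanActivity) ∈ Ico 0 1 ∧
      2 * W * Real.artanh (W / (τ * P.meanActivity)) ≤ P.totalProduction := by
  have hT : τ * P.meanActivity = ∫ t in (0 : ℝ)..τ, P.activity t := by
    rw [meanActivity]; field_simp
  rw [hT]
  exact speed_limit_of_forall_le (fun F _ => P.tangent_le_totalProduction hτ hsum F) hW hWE

end FeedbackProcess

/-! ### Entropy inequalities -/

/-- Strict concavity, from `log z ≤ z - 1` with equality only at `z = 1`. The strict part later
yields uniqueness of the entropy maximizer. -/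
theorem negMulLog_le_tangent {a b : ℝ} (ha : 0 ≤ a) (hb : 0 < b) :
    Real.negMulLog a ≤ Real.negMulLog b + (-1 - Real.log b) * (a - b) ∧
      (a ≠ b → Real.negMulLog a < Real.negMulLog b + (-1 - Real.log b) * (a - b)) := by
  rcases ha.eq_or_lt with rfl | ha
  · have : Real.negMulLog b + (-1 - Real.log b) * (0 - b) = b := by rw [Real.negMulLog]; ring
    rw [this, Real.negMulLog_zero]
    exact ⟨hb.le, fun _ => hb⟩
  · have h : Real.negMulLog b + (-1 - Real.log b) * (a - b) - Real.negMulLog a =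
        a * ((b / a - 1) - Real.log (b / a)) := by
      rw [Real.negMulLog, Real.negMulLog, Real.log_div hb.ne' ha.ne']
      field_simp
      ring
    constructor
    · have := mul_nonneg ha.le (sub_nonneg.2 (Real.log_le_sub_one_of_pos (div_pos hb ha)))
      linarith
    · intro hne
      have hne' : b / a ≠ 1 := fun h => hne ((div_eq_one_iff_eq ha.ne').1 h).symm
      have := mul_pos ha (sub_pos.2 (Real.log_lt_sub_one_of_pos (div_pos hb ha) hne'))
      linarith

theorem shannon_comp_equiv {ι κ : Type*} [Fintype ι] [Fintype κ] (e : ι ≃ κ) (p : κ → ℝ) :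
    shannon (fun i => p (e i)) = shannon p :=
  Equiv.sum_comp e fun k => Real.negMulLog (p k)

theorem shannon_prod_eq {n : ℕ} (p : Fin n → Fin n → ℝ) :
    shannon (fun z : Fin n × Fin n => p z.1 z.2) = ∑ x, ∑ y, Real.negMulLog (p x y) := by
  rw [shannon, Fintype.sum_prod_type]

/-- Conditional entropy of `Y` given `X`. -/
def condEntropy {n : ℕ} (p : Fin n → Fin n → ℝ) : ℝ :=
  shannon (fun z : Fin n × Fin n => p z.1 z.2) - shannon (marginalX p)

theorem condEntropy_nonneg {n : ℕ} {p : Fin n → Fin n → ℝ} (hp : ∀ x y, 0 ≤ p x y) :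
    0 ≤ condEntropy p := by
  rw [condEntropy, shannon_prod_eq, shannon, ← Finset.sum_sub_distrib]
  refine Finset.sum_nonneg fun x _ => sub_nonneg.2 ?_
  have : Real.negMulLog (marginalX p x) = ∑ y, -(p x y * Real.log (marginalX p x)) := by
    rw [Real.negMulLog, Finset.sum_neg_distrib, ← Finset.sum_mul, neg_mul]; rfl
  rw [this]
  refine Finset.sum_le_sum fun y _ => ?_
  rw [Real.negMulLog, neg_mul, neg_le_neg_iff]
  rcases (hp x y).eq_or_lt with h | h
  · simp [← h]
  · exact mul_le_mul_of_nonneg_left (Real.log_le_log h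
      (Finset.single_le_sum (f := fun y => p x y) (fun y _ => hp x y) (Finset.mem_univ y))) h.le

/-- Subadditivity of the entropy. -/
theorem condEntropy_le_shannon_marginalY {n : ℕ} {p : Fin n → Fin n → ℝ}
    (hp : ∀ x y, 0 ≤ p x y) (hsum : ∑ x, ∑ y, p x y = 1) :
    condEntropy p ≤ shannon (marginalY p) := by
  rw [condEntropy, shannon_prod_eq, sub_le_iff_le_add]
  have hX : ∑ x, marginalX p x = 1 := hsum
  have hY : ∑ y, marginalY p y = 1 := by rw [← hsum, Finset.sum_comm]; rfl
  -- Gibbs' inequality termwise, from the tangent at the product of the marginals; the last two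
  -- terms cancel after summation.
  have hle : ∀ x y, Real.negMulLog (p x y) ≤ -(p x y * Real.log (marginalX p x)) -
      p x y * Real.log (marginalY p y) - p x y + marginalX p x * marginalY p y := by
    intro x y
    have h1 : p x y ≤ marginalX p x :=
      Finset.single_le_sum (f := fun y => p x y) (fun y _ => hp x y) (Finset.mem_univ y)
    have h2 : p x y ≤ marginalY p y :=
      Finset.single_le_sum (f := fun x => p x y) (fun x _ => hp x y) (Finset.mem_univ x)
    rcases (hp x y).eq_or_lt with h | h
    · rw [← h] at h1 h2 ⊢
      simpa using mul_nonneg h1 h2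
    · have hX := h.trans_le h1
      have hY := h.trans_le h2
      have := (negMulLog_le_tangent h.le (mul_pos hX hY)).1
      rw [Real.negMulLog_def] at this ⊢
      simp only [Real.log_mul hX.ne' hY.ne'] at this ⊢
      linarith
  refine (Finset.sum_le_sum fun x _ => Finset.sum_le_sum fun y _ => hle x y).trans (le_of_eq ?_)
  have e1 : ∑ x, ∑ y, p x y * Real.log (marginalX p x) = -shannon (marginalX p) := by
    rw [shannon, ← Finset.sum_neg_distrib]
    refine Finset.sum_congr rfl fun x _ => ?_
    rw [← Finset.sum_mul, Real.negMulLog, neg_mul, neg_neg]; rfl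
  have e2 : ∑ x, ∑ y, p x y * Real.log (marginalY p y) = -shannon (marginalY p) := by
    rw [shannon, ← Finset.sum_neg_distrib, Finset.sum_comm]
    refine Finset.sum_congr rfl fun y _ => ?_
    rw [← Finset.sum_mul, Real.negMulLog, neg_mul, neg_neg]; rfl
  have e3 : ∑ x, ∑ y, marginalX p x * marginalY p y = 1 := by
    rw [← Finset.sum_mul_sum, hX, hY, one_mul]
  simp only [Finset.sum_add_distrib, Finset.sum_sub_distrib, Finset.sum_neg_distrib, e1, e2, e3,
    hsum]
  ring

/-- An error-free joint law has mutual information `S(p^Y)`, and any other with this marginal has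
`S(p^Y) - H(Y|X)`. -/
theorem mutualInfo_sub_initialDist {n : ℕ} {p : Fin n → Fin n → ℝ} {pY : Fin n → ℝ}
    (h : marginalY p = pY) :
    mutualInfo p - mutualInfo (initialDist pY) = -condEntropy p := by
  have h1 : marginalX (initialDist pY) = pY := by ext x; simp [marginalX, initialDist]
  have h2 : marginalY (initialDist pY) = pY := by ext x; simp [marginalY, initialDist]
  have h3 : shannon (fun z : Fin n × Fin n => initialDist pY z.1 z.2) = shannon pY := by
    rw [shannon_prod_eq, shannon]
    refine Finset.sum_congr rfl fun x _ => ?_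
    rw [Finset.sum_eq_single x (fun y _ hy => by simp [initialDist, hy.symm]) (by simp)]
    simp [initialDist]
  rw [mutualInfo, mutualInfo, h, h1, h2, h3, condEntropy]
  ring

theorem abs_mutualInfo_sub_initialDist {n : ℕ} {p : Fin n → Fin n → ℝ} {pY : Fin n → ℝ}
    (hp : ∀ x y, 0 ≤ p x y) (h : marginalY p = pY) :
    |mutualInfo p - mutualInfo (initialDist pY)| = condEntropy p := by
  rw [mutualInfo_sub_initialDist h, abs_neg, abs_of_nonneg (condEntropy_nonneg hp)]

/-! ### The water-filling distribution -/

section WaterFill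

variable {n : ℕ} [NeZero n]

theorem sum_eq_zero_add_sum_Ioi (f : Fin n → ℝ) : ∑ k, f k = f 0 + ∑ k ∈ Finset.Ioi 0, f k := by
  have : Finset.Ioi (0 : Fin n) = Finset.univ.erase 0 := by
    ext k; simp [Fin.pos_iff_ne_zero]
  rw [this, Finset.add_sum_erase _ _ (Finset.mem_univ _)]

/-- The mass of `min θ (d k)`, `k ≠ 0`. -/
def fillMass (d : Fin n → ℝ) (θ : ℝ) : ℝ := ∑ k ∈ Finset.Ioi (0 : Fin n), min θ (d k)

/-- `d` cut off at the level `θ`, the surplus being moved to the state `0`. -/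
def waterFill (d : Fin n → ℝ) (θ : ℝ) (k : Fin n) : ℝ :=
  if k = 0 then 1 - fillMass d θ else min θ (d k)

/-- A probability vector in descending order. -/
structure IsDescending (d : Fin n → ℝ) : Prop where
  nonneg : ∀ k, 0 ≤ d k
  sum_eq : ∑ k, d k = 1
  anti : Antitone d

variable {d : Fin n → ℝ} (hd : IsDescending d) {θ : ℝ}

theorem fillMass_mono (d : Fin n → ℝ) : Monotone (fillMass d) := fun _ _ h =>
  Finset.sum_le_sum fun _ _ => min_le_min_right _ h

theorem continuous_fillMass (d : Fin n → ℝ) : Continuous (fillMass d) := by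
  unfold fillMass; fun_prop

theorem continuous_shannon_waterFill (d : Fin n → ℝ) :
    Continuous fun θ => shannon (waterFill d θ) := by
  unfold shannon
  refine continuous_finsetSum _ fun k _ => Real.continuous_negMulLog.comp ?_
  unfold waterFill
  have := continuous_fillMass d
  split_ifs <;> fun_prop

theorem sum_waterFill (d : Fin n → ℝ) (θ : ℝ) : ∑ k, waterFill d θ k = 1 := by
  rw [sum_eq_zero_add_sum_Ioi]
  have : ∑ k ∈ Finset.Ioi (0 : Fin n), waterFill d θ k = fillMass d θ :=
    Finset.sum_congr rfl fun k hk => if_neg (Finset.mem_Ioi.1 hk).ne'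
  rw [this]; simp [waterFill]

include hd

theorem IsDescending.sum_Ioi : ∑ k ∈ Finset.Ioi (0 : Fin n), d k = 1 - d 0 := by
  have := sum_eq_zero_add_sum_Ioi d
  rw [hd.sum_eq] at this
  linarith

theorem fillMass_zero : fillMass d 0 = 0 :=
  Finset.sum_eq_zero fun k _ => min_eq_left (hd.nonneg k)

theorem fillMass_top : fillMass d (d 0) = 1 - d 0 := by
  rw [← hd.sum_Ioi]
  exact Finset.sum_congr rfl fun k _ => min_eq_right (hd.anti (Fin.zero_le k))

theorem fillMass_le (θ : ℝ) : fillMass d θ ≤ 1 - d 0 := by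
  rw [← hd.sum_Ioi]
  exact Finset.sum_le_sum fun k _ => min_le_right _ _

theorem fillMass_mem (hθ : θ ∈ Icc 0 (d 0)) : fillMass d θ ∈ Icc 0 (1 - d 0) :=
  ⟨(fillMass_zero hd).symm.le.trans (fillMass_mono d hθ.1), fillMass_le hd θ⟩

/-- Allows the error `W` to be parametrized by a water level `θ`, in which the distribution is
continuous and has no case distinction at the cutoff. -/
theorem exists_fillMass_eq {W : ℝ} (hW : W ∈ Icc 0 (1 - d 0)) :
    ∃ θ ∈ Icc 0 (d 0), fillMass d θ = W := by
  have := intermediate_value_Icc (hd.nonneg 0) (continuous_fillMass d).continuousOn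
  rw [fillMass_zero hd, fillMass_top hd] at this
  exact this hW

theorem waterFill_top : waterFill d (d 0) = d := by
  ext k
  rw [waterFill]
  split_ifs with h
  · rw [fillMass_top hd, h]; ring
  · exact min_eq_right (hd.anti (Fin.zero_le k))

theorem waterFill_zero_level : waterFill d 0 = Pi.single 0 1 := by
  ext k
  rw [waterFill, fillMass_zero hd, Pi.single_apply]
  split_ifs with h
  · ring
  · exact min_eq_left (hd.nonneg k)

theorem shannon_waterFill_zero : shannon (waterFill d 0) = 0 := by
  rw [waterFill_zero_level hd, shannon]
  refine Finset.sum_eq_zero fun k _ => ?_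
  rw [Pi.single_apply]
  split_ifs <;> simp

theorem waterFill_nonneg (hθ : 0 ≤ θ) (k : Fin n) : 0 ≤ waterFill d θ k := by
  rw [waterFill]
  split_ifs
  · linarith [fillMass_le hd θ, hd.nonneg 0]
  · exact le_min hθ (hd.nonneg k)

/-- `waterFill d θ` has the largest entropy under the given constraints. -/
theorem shannon_le_shannon_waterFill (hθ : θ ∈ Icc 0 (d 0)) {q : Fin n → ℝ}
    (hq : ∀ k, 0 ≤ q k) (hqs : ∑ k, q k = 1) (hq0 : 1 - fillMass d θ ≤ q 0)
    (hqd : ∀ k, k ≠ 0 → q k ≤ d k) :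
    shannon q ≤ shannon (waterFill d θ) ∧
      (q ≠ waterFill d θ → shannon q < shannon (waterFill d θ)) := by
  -- At level `0` the multiplier `-1 - log θ` used below has no meaning, but the constraints leave
  -- only the point mass.
  rcases hθ.1.eq_or_lt with h0 | h0
  · rw [← h0, fillMass_zero hd] at hq0
    have hq1 : ∑ k ∈ Finset.Ioi (0 : Fin n), q k ≤ 0 := by
      have := sum_eq_zero_add_sum_Ioi q
      linarith
    have hz := (Finset.sum_eq_zero_iff_of_nonneg fun k _ => hq k).1
      (le_antisymm hq1 (Finset.sum_nonneg fun k _ => hq k))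
    have heq : q = waterFill d θ := by
      rw [← h0, waterFill_zero_level hd]
      ext k
      by_cases hk : k = 0
      · have := sum_eq_zero_add_sum_Ioi q
        rw [Finset.sum_eq_zero hz, hqs] at this
        simp [hk, this]
      · rw [hz k (Finset.mem_Ioi.2 (Fin.pos_iff_ne_zero.2 hk))]
        simp [hk]
    rw [← heq]
    exact ⟨le_rfl, fun h => absurd rfl h⟩
  -- The slope `-1 - log θ` is a common Lagrange multiplier. Where the water filling differs from
  -- `θ`, a constraint binds: at `0` it exceeds `θ` and `q` can only be larger, while at a `d k < θ`
  -- the law `q` can only be smaller. Either way, replacing the true slope by the common one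
  -- increases the bound. The linear terms then sum to zero.
  have key : ∀ k, Real.negMulLog (q k) ≤ Real.negMulLog (waterFill d θ k) +
      (-1 - Real.log θ) * (q k - waterFill d θ k) ∧ (q k ≠ waterFill d θ k →
      Real.negMulLog (q k) < Real.negMulLog (waterFill d θ k) +
      (-1 - Real.log θ) * (q k - waterFill d θ k)) := by
    intro k
    rcases (waterFill_nonneg hd hθ.1 k).eq_or_lt with hw | hw
    · have : q k = 0 := by
        by_cases hk : k = 0
        · rw [waterFill, if_pos hk] at hw
          linarith [fillMass_le hd θ, hθ.2]
        · rw [waterFill, if_neg hk] at hw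
          rcases min_choice θ (d k) with h | h <;> rw [h] at hw
          · exact absurd hw h0.ne
          · exact le_antisymm ((hqd k hk).trans hw.symm.le) (hq k)
      rw [← hw, this]
      simp
    · have ht := negMulLog_le_tangent (hq k) hw
      have hslope : (-1 - Real.log (waterFill d θ k)) * (q k - waterFill d θ k) ≤
          (-1 - Real.log θ) * (q k - waterFill d θ k) := by
        by_cases hk : k = 0
        · subst hk
          have h1 : θ ≤ waterFill d θ 0 := by
            rw [waterFill, if_pos rfl]; linarith [fillMass_le hd θ, hθ.2]
          have h2 : waterFill d θ 0 ≤ q 0 := by rwa [waterFill, if_pos rfl]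
          exact mul_le_mul_of_nonneg_right (by linarith [Real.log_le_log h0 h1]) (by linarith)
        · have hwk : waterFill d θ k = min θ (d k) := by rw [waterFill, if_neg hk]
          rcases le_total θ (d k) with h | h
          · rw [hwk, min_eq_left h]
          · rw [min_eq_right h] at hwk
            rw [hwk] at hw ⊢
            exact mul_le_mul_of_nonpos_right (by linarith [Real.log_le_log hw h])
              (by linarith [hqd k hk])
      exact ⟨ht.1.trans (by linarith), fun h => (ht.2 h).trans_le (by linarith)⟩
  have hrhs : ∑ k, (Real.negMulLog (waterFill d θ k) +
      (-1 - Real.log θ) * (q k - waterFill d θ k)) = shannon (waterFill d θ) := by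
    rw [Finset.sum_add_distrib, ← Finset.mul_sum, Finset.sum_sub_distrib, hqs, sum_waterFill]
    simp [shannon]
  constructor
  · rw [← hrhs]
    exact Finset.sum_le_sum fun k _ => (key k).1
  · intro hne
    obtain ⟨k, hk⟩ := Function.ne_iff.1 hne
    rw [← hrhs]
    exact Finset.sum_lt_sum (fun k _ => (key k).1) ⟨k, Finset.mem_univ k, (key k).2 hk⟩

/-- The distribution with the smaller mass is feasible in the maximization for the larger one, and
differs from its unique maximizer at state `0`. -/
theorem shannon_waterFill_strictMono {θ' : ℝ} (hθ : θ ∈ Icc 0 (d 0)) (hθ' : θ' ∈ Icc 0 (d 0))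
    (h : fillMass d θ < fillMass d θ') :
    shannon (waterFill d θ) < shannon (waterFill d θ') := by
  refine (shannon_le_shannon_waterFill hd hθ' (waterFill_nonneg hd hθ.1) (sum_waterFill d θ)
    ?_ ?_).2 ?_
  · simp only [waterFill, if_true]; linarith
  · intro k hk
    rw [waterFill, if_neg hk]
    exact min_le_right _ _
  · intro heq
    have := congrFun heq 0
    simp only [waterFill, if_true] at this
    linarith

theorem shannon_waterFill_mem (hθ : θ ∈ Icc 0 (d 0)) :
    shannon (waterFill d θ) ∈ Icc 0 (shannon d) := by
  constructor
  · refine Finset.sum_nonneg fun k _ => Real.negMulLog_nonneg (waterFill_nonneg hd hθ.1 k) ?_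
    rw [← sum_waterFill d θ]
    exact Finset.single_le_sum (fun k _ => waterFill_nonneg hd hθ.1 k) (Finset.mem_univ k)
  · conv_rhs => rw [← waterFill_top hd]
    rcases (fillMass_le hd θ).eq_or_lt with h | h
    · refine (shannon_le_shannon_waterFill hd ⟨hd.nonneg 0, le_rfl⟩ (waterFill_nonneg hd hθ.1)
        (sum_waterFill d θ) ?_ fun k hk => ?_).1
      · simp only [waterFill, if_true]; rw [h, fillMass_top hd]
      · rw [waterFill, if_neg hk]; exact min_le_right _ _
    · refine (shannon_waterFill_strictMono hd hθ ⟨hd.nonneg 0, le_rfl⟩ ?_).le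
      rwa [fillMass_top hd]

theorem exists_shannon_waterFill_eq {I : ℝ} (hI : I ∈ Icc 0 (shannon d)) :
    ∃ θ ∈ Icc 0 (d 0), shannon (waterFill d θ) = I := by
  have := intermediate_value_Icc (hd.nonneg 0) (continuous_shannon_waterFill d).continuousOn
  rw [shannon_waterFill_zero hd, waterFill_top hd] at this
  exact this hI

end WaterFill

/-! ### The achievable Fano inequality -/

section Fano

variable {n : ℕ}

theorem isDescending_sortDesc {p : Fin n → ℝ} (hpos : ∀ y, 0 ≤ p y) (hsum : ∑ y, p y = 1) :
    IsDescending (sortDesc p) where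
  nonneg _ := hpos _
  sum_eq := by
    rw [← hsum]
    exact Equiv.sum_comp (Tuple.sort fun i => -p i) p
  anti i j h := by
    have := Tuple.monotone_sort (fun i => -p i) h
    simp only [Function.comp_apply] at this
    simp only [sortDesc]
    linarith

theorem shannon_sortDesc (p : Fin n → ℝ) : shannon (sortDesc p) = shannon p :=
  shannon_comp_equiv (Tuple.sort fun i => -p i) p

/-- Ties make the ranking ambiguous, but not the sorted values, so any descending `σ` may replace
the one chosen by `Tuple.sort`. -/
theorem sortDesc_eq {p : Fin n → ℝ} {σ : Equiv.Perm (Fin n)}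
    (hσ : Antitone fun k => p (σ.symm k)) (y : Fin n) : sortDesc p (σ y) = p y := by
  have h1 : Monotone ((fun i => -p i) ∘ σ.symm) := fun i j h => neg_le_neg (hσ h)
  have h2 := congrFun (Tuple.comp_sort_eq_comp_iff_monotone.2 h1) (σ y)
  simp only [Function.comp_apply, Equiv.symm_apply_apply] at h2
  simp only [sortDesc]
  linarith

theorem sum_ite_lt (f : Fin n → ℝ) (k : Fin n) :
    (∑ j, if k < j then f j else 0) = ∑ j ∈ Finset.Ioi k, f j := by
  rw [← Finset.sum_filter, Finset.filter_lt_eq_Ioi]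

/-- In each row `x` the entries at `x` and `y₀` are swapped if this makes the entry at `y₀` larger.
Row permutations leave `H(Y|X)` unchanged, entries away from `y₀` can only decrease, and the entry
at `y₀` becomes the maximum of the two. The new `Y`-marginal is `r`; subadditivity bounds the
entropy. -/
theorem exists_bound_condEntropy {q : Fin n → Fin n → ℝ} (hq : ∀ x y, 0 ≤ q x y)
    (hsum : ∑ x, ∑ y, q x y = 1) (y₀ : Fin n) :
    ∃ r : Fin n → ℝ, (∀ y, 0 ≤ r y) ∧ ∑ y, r y = 1 ∧ condEntropy q ≤ shannon r ∧
      marginalY q y₀ ≤ r y₀ ∧ ∑ y, q y y ≤ r y₀ ∧ ∀ y, y ≠ y₀ → r y ≤ marginalY q y := by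
  set f : Fin n → Fin n := fun x => if q x y₀ ≤ q x x then x else y₀ with hf
  set e : Fin n → Equiv.Perm (Fin n) := fun x => Equiv.swap (f x) y₀ with he
  set q' : Fin n → Fin n → ℝ := fun x y => q x (e x y) with hq'
  have hX : marginalX q' = marginalX q := by
    ext x; exact Equiv.sum_comp (e x) (q x)
  have hsum' : ∑ x, ∑ y, q' x y = 1 := by
    rw [← hsum]; exact Finset.sum_congr rfl fun x _ => congrFun hX x
  have hH : condEntropy q' = condEntropy q := by
    rw [condEntropy, condEntropy, hX, shannon_prod_eq, shannon_prod_eq]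
    congr 1
    exact Finset.sum_congr rfl fun x _ => Equiv.sum_comp (e x) fun y => Real.negMulLog (q x y)
  have hpos : ∀ x y, 0 ≤ q' x y := fun x y => hq _ _
  refine ⟨marginalY q', fun y => Finset.sum_nonneg fun x _ => hpos x y, ?_, ?_, ?_, ?_, ?_⟩
  · rw [← hsum', Finset.sum_comm]; rfl
  · rw [← hH]; exact condEntropy_le_shannon_marginalY hpos hsum'
  · refine Finset.sum_le_sum fun x _ => ?_
    simp only [hq', he, Equiv.swap_apply_right, hf]
    split_ifs with h
    exacts [h, le_rfl]
  · refine Finset.sum_le_sum fun x _ => ?_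
    simp only [hq', he, Equiv.swap_apply_right, hf]
    split_ifs with h
    exacts [le_rfl, (not_le.1 h).le]
  · intro y hy
    refine Finset.sum_le_sum fun x _ => ?_
    simp only [hq', he, hf]
    split_ifs with h
    · by_cases hxy : y = x
      · subst hxy; simpa using h
      · rw [Equiv.swap_apply_of_ne_of_ne hxy hy]
    · simp

variable [NeZero n]

theorem sum_Ioi_zero_split (f : Fin n → ℝ) (k : Fin n) : ∑ j ∈ Finset.Ioi (0 : Fin n), f j =
    ∑ j ∈ Finset.Ioc 0 k, f j + ∑ j ∈ Finset.Ioi k, f j := by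
  rw [← Finset.sum_union]
  · congr 1
    ext j
    simp only [Finset.mem_Ioi, Finset.mem_union, Finset.mem_Ioc]
    have := Fin.zero_le k
    constructor
    · intro h
      rcases le_or_gt j k with h' | h'
      exacts [Or.inl ⟨h, h'⟩, Or.inr h']
    · rintro (h | h)
      exacts [h.1, this.trans_lt h]
  · rw [Finset.disjoint_left]
    intro j h1 h2
    exact absurd (Finset.mem_Ioc.1 h1).2 (not_le.2 (Finset.mem_Ioi.1 h2))

/-- The mass is split at `k`. If `θ < d k`, the `k` terms up to `k` are at most `θ` each and the
tail at most that of `d`; if `d k ≤ θ`, those terms are at least `d k` each and the tail is exactly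
that of `d`. -/
theorem fill_condition_iff {d : Fin n → ℝ} (hd : Antitone d) (θ : ℝ) {k : Fin n} (hk : 0 < k.val) :
    (fillMass d θ - ∑ j, if k < j then d j else 0) / (k.val : ℝ) < d k ↔ θ < d k := by
  have hk' : (0 : ℝ) < k.val := by exact_mod_cast hk
  have hcard : ∀ c : ℝ, ∑ _j ∈ Finset.Ioc 0 k, c = k.val * c := fun c => by simp
  rw [sum_ite_lt, fillMass, sum_Ioi_zero_split _ k, div_lt_iff₀ hk']
  have h2 : ∑ j ∈ Finset.Ioi k, min θ (d j) ≤ ∑ j ∈ Finset.Ioi k, d j :=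
    Finset.sum_le_sum fun j _ => min_le_right _ _
  constructor
  · intro h
    by_contra! hle
    have h1 : ∑ _j ∈ Finset.Ioc 0 k, d k ≤ ∑ j ∈ Finset.Ioc 0 k, min θ (d j) :=
      Finset.sum_le_sum fun j hj => le_min hle (hd (Finset.mem_Ioc.1 hj).2)
    have h3 : ∑ j ∈ Finset.Ioi k, min θ (d j) = ∑ j ∈ Finset.Ioi k, d j :=
      Finset.sum_congr rfl fun j hj =>
        min_eq_right ((hd (Finset.mem_Ioi.1 hj).le).trans hle)
    rw [hcard] at h1
    linarith
  · intro h
    have h1 : ∑ j ∈ Finset.Ioc 0 k, min θ (d j) ≤ ∑ _j ∈ Finset.Ioc 0 k, θ :=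
      Finset.sum_le_sum fun j _ => min_le_left _ _
    rw [hcard] at h1
    have := mul_lt_mul_of_pos_left h hk'
    linarith

variable {p : Fin n → ℝ} (hd : IsDescending (sortDesc p)) {θ : ℝ}

include hd

theorem succ_le_cutoff_iff {k : Fin n} (hk : k ≠ 0) :
    k.val + 1 ≤ cutoff p (fillMass (sortDesc p) θ) ↔ θ < sortDesc p k := by
  have hpos : ∀ {k : Fin n}, 0 < k.val ↔ k ≠ 0 := fun {k} => by
    rw [← Fin.pos_iff_ne_zero]; rfl
  rw [cutoff, Finset.le_sup_iff (by simp)]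
  simp only [Finset.mem_filter, Finset.mem_univ, true_and, add_le_add_iff_right]
  constructor
  · rintro ⟨j, ⟨hj, hlt⟩, hle⟩
    exact ((fill_condition_iff hd.anti θ hj).1 hlt).trans_le (hd.anti hle)
  · intro h
    exact ⟨k, ⟨hpos.2 hk, (fill_condition_iff hd.anti θ (hpos.2 hk)).2 h⟩, le_rfl⟩

theorem exists_cutoff_eq (hlt : fillMass (sortDesc p) θ < 1 - sortDesc p 0) :
    ∃ m : Fin n, m ≠ 0 ∧ θ < sortDesc p m ∧
      cutoff p (fillMass (sortDesc p) θ) = m.val + 1 := by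
  have hex : ∃ k : Fin n, k ≠ 0 ∧ θ < sortDesc p k := by
    by_contra! h
    refine hlt.ne ?_
    rw [← hd.sum_Ioi]
    exact Finset.sum_congr rfl fun k hk => min_eq_right (h k (Finset.mem_Ioi.1 hk).ne')
  obtain ⟨k, hk, hkθ⟩ := hex
  have hne : (Finset.univ.filter (fun k : Fin n => 0 < k.val ∧
    (fillMass (sortDesc p) θ - ∑ j, if k < j then sortDesc p j else 0) / (k.val : ℝ) <
      sortDesc p k)).Nonempty := by
    have hk0 : 0 < k.val := Fin.pos_iff_ne_zero.2 hk
    exact ⟨k, by simpa using ⟨hk0, (fill_condition_iff hd.anti θ hk0).2 hkθ⟩⟩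
  obtain ⟨m, hm, hsup⟩ := Finset.exists_mem_eq_sup _ hne (fun k : Fin n => k.val + 1)
  simp only [Finset.mem_filter, Finset.mem_univ, true_and] at hm
  refine ⟨m, ?_, (fill_condition_iff hd.anti θ hm.1).1 hm.2, hsup⟩
  rintro rfl
  exact absurd hm.1 (by simp)

/-- The cutoff is the last rank whose value exceeds the level. Removing the tail from the mass thus
leaves `M - 1` copies of `θ`, and the quotient in the definition recovers `θ`. -/
theorem fanoDist_fillMass (θ : ℝ) :
    fanoDist p (fillMass (sortDesc p) θ) = waterFill (sortDesc p) θ := by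
  ext k
  rw [fanoDist, waterFill]
  split_ifs with h1 h2 h2 h3
  · have := fillMass_le hd θ
    rw [h2]; linarith
  · have h := (fillMass_le hd θ).antisymm (by linarith)
    rw [← hd.sum_Ioi] at h
    exact ((Finset.sum_eq_sum_iff_of_le fun k _ => min_le_right _ _).1 h k
      (Finset.mem_Ioi.2 (Fin.pos_iff_ne_zero.2 h2))).symm
  · rfl
  · obtain ⟨m, hm0, hmθ, hM⟩ := exists_cutoff_eq hd (θ := θ) (by linarith)
    rw [min_eq_left ((succ_le_cutoff_iff hd h2).1 h3).le]
    have hm : (0 : ℝ) < m.val := by exact_mod_cast Fin.pos_iff_ne_zero.2 hm0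
    have htail : (∑ j : Fin n, if cutoff p (fillMass (sortDesc p) θ) < j.val + 1
        then sortDesc p j else 0) = ∑ j ∈ Finset.Ioi m, sortDesc p j := by
      rw [← sum_ite_lt, hM]
      simp only [add_lt_add_iff_right, Fin.lt_def]
    have e1 : ∑ j ∈ Finset.Ioc 0 m, min θ (sortDesc p j) = m.val * θ := by
      rw [Finset.sum_congr rfl fun j hj => min_eq_left
        (hmθ.le.trans (hd.anti (Finset.mem_Ioc.1 hj).2))]
      simp
    have e2 : ∑ j ∈ Finset.Ioi m, min θ (sortDesc p j) = ∑ j ∈ Finset.Ioi m, sortDesc p j := by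
      refine Finset.sum_congr rfl fun j hj => min_eq_right (le_of_not_gt fun hlt => ?_)
      have hj' := Finset.mem_Ioi.1 hj
      have hj0 : j ≠ 0 := ((Fin.zero_le m).trans_lt hj').ne'
      have := (succ_le_cutoff_iff hd hj0).2 hlt
      rw [hM] at this
      have := Fin.lt_def.1 hj'
      omega
    rw [htail, hM]
    nth_rewrite 1 [fillMass]
    rw [sum_Ioi_zero_split _ m, e1, e2]
    push_cast
    rw [add_sub_cancel_right, add_sub_cancel_right, mul_div_cancel_left₀ _ hm.ne']
  · exact (min_eq_right (le_of_not_gt fun h =>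
      h3 ((succ_le_cutoff_iff hd h2).2 h))).symm

theorem bijOn_shannon_fanoDist :
    BijOn (fun W => shannon (fanoDist p W)) (Icc 0 (1 - sortDesc p 0)) (Icc 0 (shannon p)) := by
  refine ⟨?_, ?_, ?_⟩
  · intro W hW
    obtain ⟨θ, hθ, rfl⟩ := exists_fillMass_eq hd hW
    simp only [fanoDist_fillMass hd θ]
    rw [← shannon_sortDesc p]
    exact shannon_waterFill_mem hd hθ
  · refine StrictMonoOn.injOn fun W hW W' hW' hlt => ?_
    obtain ⟨θ, hθ, rfl⟩ := exists_fillMass_eq hd hW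
    obtain ⟨θ', hθ', rfl⟩ := exists_fillMass_eq hd hW'
    simp only [fanoDist_fillMass hd θ, fanoDist_fillMass hd θ']
    exact shannon_waterFill_strictMono hd hθ hθ' hlt
  · intro I hI
    rw [← shannon_sortDesc p] at hI
    obtain ⟨θ, hθ, rfl⟩ := exists_shannon_waterFill_eq hd hI
    refine ⟨_, fillMass_mem hd hθ, ?_⟩
    simp only [fanoDist_fillMass hd θ]

theorem exists_level_minWasserstein {I : ℝ} (hI : I ∈ Icc 0 (shannon p)) :
    ∃ θ ∈ Icc 0 (sortDesc p 0), minWasserstein p I = fillMass (sortDesc p) θ ∧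
      shannon (waterFill (sortDesc p) θ) = I := by
  have hs := (bijOn_shannon_fanoDist hd).surjOn
  have hmem : minWasserstein p I ∈ Icc 0 (1 - sortDesc p 0) := hs.mapsTo_invFunOn hI
  have heq : shannon (fanoDist p (minWasserstein p I)) = I := hs.rightInvOn_invFunOn hI
  obtain ⟨θ, hθ, hW⟩ := exists_fillMass_eq hd hmem
  refine ⟨θ, hθ, hW.symm, ?_⟩
  rw [← fanoDist_fillMass hd θ, hW, heq]

theorem minWasserstein_eq_zero_iff {I : ℝ} (hI : I ∈ Icc 0 (shannon p)) :
    minWasserstein p I = 0 ↔ I = 0 := by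
  have hb := bijOn_shannon_fanoDist hd
  have hmem : minWasserstein p I ∈ Icc 0 (1 - sortDesc p 0) := hb.surjOn.mapsTo_invFunOn hI
  have heq : shannon (fanoDist p (minWasserstein p I)) = I := hb.surjOn.rightInvOn_invFunOn hI
  have h0 : shannon (fanoDist p 0) = 0 := by
    have := fanoDist_fillMass hd 0
    rw [fillMass_zero hd] at this
    rw [this, shannon_waterFill_zero hd]
  constructor
  · intro h
    rw [← heq, h, h0]
  · intro h
    exact hb.injOn hmem ⟨le_rfl, hmem.1.trans hmem.2⟩ (heq.trans (h.trans h0.symm))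

omit hd

/-- Achievable Fano inequality. -/
theorem fano_inequality {q : Fin n → Fin n → ℝ} (hpos : ∀ y, 0 ≤ p y) (hp : ∑ y, p y = 1)
    (hq : ∀ x y, 0 ≤ q x y) (hY : marginalY q = p) :
    condEntropy q ≤ shannon p ∧ minWasserstein p (condEntropy q) ≤ 1 - ∑ y, q y y := by
  have hd := isDescending_sortDesc hpos hp
  have hsum : ∑ x, ∑ y, q x y = 1 := by rw [Finset.sum_comm, ← hp, ← hY]; rfl
  obtain ⟨r, hr0, hr1, hHr, hry, hrE, hrle⟩ :=
    exists_bound_condEntropy hq hsum (Tuple.sort (fun i => -p i) 0)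
  rw [hY] at hry hrle
  set s := Tuple.sort (fun i => -p i) with hs
  set r' : Fin n → ℝ := fun k => r (s k) with hr'
  have hSr : shannon r' = shannon r := shannon_comp_equiv s r
  have hr's : ∑ k, r' k = 1 := by rw [← hr1]; exact Equiv.sum_comp s r
  have hr'le : ∀ k, k ≠ 0 → r' k ≤ sortDesc p k := fun k hk =>
    hrle _ fun h => hk (s.injective h)
  have hle : condEntropy q ≤ shannon p := by
    -- At the top level the maximizer is `p↓` itself; the constraint at rank `0` is then `hry`.
    have := (shannon_le_shannon_waterFill hd (θ := sortDesc p 0) ⟨hd.nonneg 0, le_rfl⟩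
      (fun k => hr0 (s k)) hr's (by rw [fillMass_top hd]; simpa [sortDesc] using hry) hr'le).1
    rw [waterFill_top hd, shannon_sortDesc] at this
    exact hHr.trans (hSr ▸ this)
  refine ⟨hle, ?_⟩
  obtain ⟨θ, hθ, hW, hI⟩ := exists_level_minWasserstein hd
    (I := condEntropy q) ⟨condEntropy_nonneg hq, hle⟩
  rw [hW]
  -- An error below `W` would make `r'` feasible at level `θ` but different from the maximizer,
  -- hence of entropy strictly below `S(p̃_W) = H(Y|X)`.
  by_contra! hlt
  have hlt' : 1 - fillMass (sortDesc p) θ < r' 0 := by simp only [hr']; linarith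
  have := (shannon_le_shannon_waterFill hd hθ (fun k => hr0 (s k)) hr's hlt'.le hr'le).2
    fun h => by
      have := congrFun h 0
      simp only [waterFill, if_true] at this
      exact hlt'.ne' this
  rw [hI] at this
  exact absurd (hHr.trans_eq hSr.symm) (not_le.2 this)

end Fano

theorem FeedbackProcess.condEntropy_eq {n : ℕ} {N : Fin n → SimpleGraph (Fin n)} {pY : Fin n → ℝ}
    {τ : ℝ} (P : FeedbackProcess N pY τ) (hτ : 0 < τ) :
    P.infoChange = -condEntropy (P.prob τ) ∧ |P.infoChange| = condEntropy (P.prob τ) := by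
  have h : τ ∈ Icc 0 τ := ⟨hτ.le, le_rfl⟩
  rw [infoChange, P.prob_zero]
  exact ⟨mutualInfo_sub_initialDist (P.marginalY_prob h),
    abs_mutualInfo_sub_initialDist (fun x y => P.prob_nonneg τ h x y) (P.marginalY_prob h)⟩

/-- The activity speed limit. -/
theorem FeedbackProcess.activity_speed_limit {n : ℕ} [NeZero n] {N : Fin n → SimpleGraph (Fin n)}
    {pY : Fin n → ℝ} {τ : ℝ} (P : FeedbackProcess N pY τ) (hpos : ∀ y, 0 ≤ pY y)
    (hsum : ∑ y, pY y = 1) (hτ : 0 < τ) {β : ℝ} (hβ : 0 < β) :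
    |P.infoChange| ≤ shannon pY ∧
      minWasserstein pY |P.infoChange| / (τ * P.meanActivity) ∈ Ico 0 1 ∧
      activityBound pY τ P.meanActivity |P.infoChange| ≤ P.entropyProduction β := by
  have h : τ ∈ Icc 0 τ := ⟨hτ.le, le_rfl⟩
  have hd := isDescending_sortDesc hpos hsum
  obtain ⟨h1, h2⟩ := P.condEntropy_eq hτ
  obtain ⟨h3, h4⟩ := fano_inequality hpos hsum (fun x y => P.prob_nonneg τ h x y)
    (P.marginalY_prob h)
  obtain ⟨θ, hθ, hW, -⟩ := exists_level_minWasserstein hd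
    (I := condEntropy (P.prob τ)) ⟨condEntropy_nonneg fun x y => P.prob_nonneg τ h x y, h3⟩
  have hW0 : 0 ≤ minWasserstein pY (condEntropy (P.prob τ)) := hW ▸ (fillMass_mem hd hθ).1
  obtain ⟨h5, h6⟩ := P.speed_limit hτ hsum hW0 h4
  rw [h2, activityBound, P.entropyProduction_eq hτ hβ, h1]
  exact ⟨h3, h5, by linarith⟩

/-! ### The optimal final distribution -/

/-- `q` couples `X` with law `pX` to `Y` with law `p`; given `x`, the state `y = x` has probability
`1 - W`, and every other state has probability `min θ (p y)`. -/
structure IsFillCoupling {n : ℕ} (p : Fin n → ℝ) (θ W : ℝ) (pX : Fin n → ℝ)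
    (q : Fin n → Fin n → ℝ) : Prop where
  level_nonneg : 0 ≤ θ
  le_one : W ≤ 1
  law_nonneg : ∀ y, 0 ≤ p y
  mass : ∑ y, min θ (p y) = W + θ
  nonneg : ∀ x, 0 ≤ pX x
  sum_eq : ∑ x, pX x = 1
  excess : ∀ x, pX x * (1 - W - θ) = max (p x - θ) 0
  support : ∀ x, pX x ≠ 0 → θ ≤ p x
  eq : ∀ x y, q x y = pX x * (if y = x then 1 - W else min θ (p y))

namespace IsFillCoupling

variable {n : ℕ} {p : Fin n → ℝ} {θ W : ℝ} {pX : Fin n → ℝ} {q : Fin n → Fin n → ℝ}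
  (h : IsFillCoupling p θ W pX q)

include h

theorem coupling_nonneg (x y : Fin n) : 0 ≤ q x y := by
  rw [h.eq]
  refine mul_nonneg (h.nonneg x) ?_
  split_ifs
  · linarith [h.le_one]
  · exact le_min h.level_nonneg (h.law_nonneg y)

/-- Every row contributes `min θ (p y)`, and the row `x = y` adds a surplus that `excess` makes
equal to `p y - θ` when `θ ≤ p y`. The product form of `excess` also covers the end point `1 - W =
θ`, where `support` takes over. -/
theorem marginalY_eq : marginalY q = p := by
  ext y
  have : ∀ x, q x y = pX x * min θ (p y) +
      (if y = x then pX x * (1 - W - min θ (p y)) else 0) := by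
    intro x
    rw [h.eq]
    split_ifs <;> ring
  simp only [marginalY, this, Finset.sum_add_distrib, ← Finset.sum_mul, h.sum_eq,
    Finset.sum_ite_eq, Finset.mem_univ, if_true]
  rcases le_total θ (p y) with hy | hy
  · have := h.excess y
    rw [max_eq_left (by linarith)] at this
    rw [min_eq_left hy, this]; ring
  · have he := h.excess y
    rw [max_eq_right (by linarith)] at he
    rw [min_eq_right hy]
    rcases mul_eq_zero.1 he with h0 | h0
    · rw [h0]; ring
    · by_cases hX : pX y = 0
      · rw [hX]; ring
      · rw [← (h.support y hX).antisymm hy, h0]; ring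

theorem sum_diag : ∑ y, q y y = 1 - W := by
  simp only [h.eq, if_true, ← Finset.sum_mul, h.sum_eq, one_mul]

/-- A row of positive weight has `θ ≤ p x`, so it replaces one value `θ` by `1 - W`. Its conditional
law therefore takes the same values with the same multiplicities for every such `x`. -/
theorem condEntropy_eq : condEntropy q =
    Real.negMulLog (1 - W) + ∑ y, Real.negMulLog (min θ (p y)) - Real.negMulLog θ := by
  set H := Real.negMulLog (1 - W) + ∑ y, Real.negMulLog (min θ (p y)) - Real.negMulLog θ with hH
  have hrow : ∀ x, ∑ y, Real.negMulLog (q x y) =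
      Real.negMulLog (marginalX q x) + pX x * H := by
    intro x
    by_cases hx : pX x = 0
    · simp [marginalX, h.eq, hx]
    · have hsplit : ∀ g : ℝ → ℝ, ∑ y, g (if y = x then 1 - W else min θ (p y)) =
          g (1 - W) + ∑ y, g (min θ (p y)) - g θ := by
        intro g
        have : ∀ y, g (if y = x then 1 - W else min θ (p y)) = g (min θ (p y)) +
            (if y = x then g (1 - W) - g θ else 0) := by
          intro y
          split_ifs with hyx
          · rw [hyx, min_eq_left (h.support x hx)]; ring
          · ring
        simp only [this, Finset.sum_add_distrib, Finset.sum_ite_eq', Finset.mem_univ, if_true]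
        ring
      have h1 := hsplit id
      simp only [id, h.mass] at h1
      have hm : marginalX q x = pX x := by
        simp only [marginalX, h.eq, ← Finset.mul_sum, h1]; ring
      rw [hm]
      simp only [h.eq, Real.negMulLog_mul, Finset.sum_add_distrib, ← Finset.sum_mul,
        ← Finset.mul_sum, h1, hsplit Real.negMulLog]
      ring
  rw [condEntropy, shannon_prod_eq, Finset.sum_congr rfl fun x _ => hrow x,
    Finset.sum_add_distrib, ← Finset.sum_mul, h.sum_eq, shannon]
  ring

end IsFillCoupling

section OptimalFinal

variable {n : ℕ} [NeZero n] {p : Fin n → ℝ} {σ : Equiv.Perm (Fin n)}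

theorem shannon_waterFill_eq (hσ : Antitone fun k => p (σ.symm k)) {θ : ℝ}
    (hθ : θ ≤ sortDesc p 0) : shannon (waterFill (sortDesc p) θ) =
      Real.negMulLog (1 - fillMass (sortDesc p) θ) + ∑ y, Real.negMulLog (min θ (p y)) -
        Real.negMulLog θ := by
  have h1 : ∑ y, Real.negMulLog (min θ (p y)) = ∑ k, Real.negMulLog (min θ (sortDesc p k)) := by
    rw [← Equiv.sum_comp σ fun k => Real.negMulLog (min θ (sortDesc p k))]
    simp only [sortDesc_eq hσ]
  rw [h1, sum_eq_zero_add_sum_Ioi (fun k => Real.negMulLog (min θ (sortDesc p k))), shannon,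
    sum_eq_zero_add_sum_Ioi]
  have h2 : ∀ k ∈ Finset.Ioi (0 : Fin n), Real.negMulLog (waterFill (sortDesc p) θ k) =
      Real.negMulLog (min θ (sortDesc p k)) := fun k hk => by
    rw [waterFill, if_neg (Finset.mem_Ioi.1 hk).ne']
  rw [Finset.sum_congr rfl h2, min_eq_left hθ, waterFill, if_pos rfl]
  ring

theorem sum_min_eq (hσ : Antitone fun k => p (σ.symm k)) {θ : ℝ} (hθ : θ ≤ sortDesc p 0) :
    ∑ y, min θ (p y) = fillMass (sortDesc p) θ + θ := by
  have h1 : ∑ y, min θ (p y) = ∑ k, min θ (sortDesc p k) := by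
    rw [← Equiv.sum_comp σ fun k => min θ (sortDesc p k)]
    simp only [sortDesc_eq hσ]
  rw [h1, sum_eq_zero_add_sum_Ioi, min_eq_left hθ, fillMass, add_comm]

theorem isFillCoupling_optimalFinal_top (hpos : ∀ y, 0 ≤ p y) (hsum : ∑ y, p y = 1)
    (hσ : Antitone fun k => p (σ.symm k)) :
    IsFillCoupling p (sortDesc p 0) (1 - sortDesc p 0) (optimalX p σ (1 - sortDesc p 0))
      (optimalFinal p σ (1 - sortDesc p 0)) := by
  have hd := isDescending_sortDesc hpos hsum
  have hle : ∀ y, p y ≤ sortDesc p 0 := fun y => by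
    rw [← sortDesc_eq hσ y]; exact hd.anti (Fin.zero_le _)
  have hX : ∀ x, optimalX p σ (1 - sortDesc p 0) x = if σ x = 0 then 1 else 0 := fun x => by
    rw [optimalX, if_pos (by linarith)]
  have hσ0 : ∀ x, σ x = 0 ↔ x = σ.symm 0 := fun x => (Equiv.eq_symm_apply σ).symm
  have hfano : fanoDist p (1 - sortDesc p 0) = sortDesc p := by
    rw [← fillMass_top hd, fanoDist_fillMass hd, waterFill_top hd]
  refine ⟨hd.nonneg 0, by linarith [hd.nonneg 0], hpos, ?_, ?_, ?_, ?_, ?_, ?_⟩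
  · rw [sum_min_eq hσ le_rfl, fillMass_top hd]
  · intro x; rw [hX]; split_ifs <;> norm_num
  · simp [hX, hσ0]
  · intro x
    rw [max_eq_right (by linarith [hle x])]
    ring
  · intro x hx
    rw [hX] at hx
    have : σ x = 0 := by by_contra h; simp [h] at hx
    rw [← sortDesc_eq hσ x, this]
  · intro x y
    rw [optimalFinal, hX, optimalCond, hfano]
    by_cases hx : σ x = 0
    · rcases eq_or_ne y x with rfl | hyx
      · simp
      · have hy : σ y ≠ 0 := fun h => hyx (σ.injective (h.trans hx.symm))
        simp only [hx, hyx, hy, if_true, if_false]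
        rw [sortDesc_eq hσ, min_eq_right (hle y)]
    · simp [hx]

theorem isFillCoupling_optimalFinal_of_lt (hpos : ∀ y, 0 ≤ p y) (hsum : ∑ y, p y = 1)
    (hσ : Antitone fun k => p (σ.symm k)) {θ : ℝ} (hθ : 0 ≤ θ)
    (hlt : fillMass (sortDesc p) θ < 1 - sortDesc p 0) :
    IsFillCoupling p θ (fillMass (sortDesc p) θ) (optimalX p σ (fillMass (sortDesc p) θ))
      (optimalFinal p σ (fillMass (sortDesc p) θ)) := by
  have hd := isDescending_sortDesc hpos hsum
  obtain ⟨m, hm0, hmθ, hM⟩ := exists_cutoff_eq hd hlt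
  have hθ0 : θ < sortDesc p 0 := hmθ.trans_le (hd.anti (Fin.zero_le m))
  have hm1 : 0 < m.val := Fin.pos_iff_ne_zero.2 hm0
  -- The nonzero rank `m` forces `2 ≤ n`; otherwise the literal `1` would be `0`.
  have hone : (1 : Fin n).val = 1 := by
    rw [Fin.val_one', Nat.mod_eq_of_lt (by omega)]
  have h10 : (1 : Fin n) ≠ 0 := fun h => by
    have := congrArg Fin.val h
    rw [hone] at this
    simp at this
  have h1m : (1 : Fin n) ≤ m := Fin.le_def.2 (by omega)
  have hfano0 : fanoDist p (fillMass (sortDesc p) θ) 0 = 1 - fillMass (sortDesc p) θ := by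
    rw [fanoDist_fillMass hd, waterFill, if_pos rfl]
  have hfano : ∀ k, k ≠ 0 → fanoDist p (fillMass (sortDesc p) θ) k = min θ (sortDesc p k) :=
    fun k hk => by rw [fanoDist_fillMass hd, waterFill, if_neg hk]
  have hfano1 : fanoDist p (fillMass (sortDesc p) θ) 1 = θ := by
    rw [hfano 1 h10, min_eq_left (hmθ.le.trans (hd.anti h1m))]
  set W := fillMass (sortDesc p) θ with hW
  have hc : 0 < 1 - W - θ := by linarith
  have hX : ∀ x, optimalX p σ W x = max (p x - θ) 0 / (1 - W - θ) := by
    intro x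
    have hiff : (σ x).val + 1 ≤ cutoff p W ↔ θ < p x := by
      rw [← sortDesc_eq hσ x]
      by_cases hx : σ x = 0
      · rw [hx, hM]
        simp [hθ0]
      · exact succ_le_cutoff_iff hd hx
    rw [optimalX, if_neg (by linarith), hfano0, hfano1]
    split_ifs with h
    · rw [max_eq_left (by linarith [hiff.1 h])]
    · rw [max_eq_right (by linarith [not_lt.1 (mt hiff.2 h)]), zero_div]
  have hsupp : ∀ x, optimalX p σ W x ≠ 0 → θ ≤ p x := by
    intro x hx
    by_contra! h
    rw [hX, max_eq_right (by linarith), zero_div] at hx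
    exact hx rfl
  refine ⟨hθ, by linarith [hd.nonneg 0], hpos, sum_min_eq hσ hθ0.le, ?_, ?_, ?_, hsupp, ?_⟩
  · intro x; rw [hX]; positivity
  · simp only [hX, ← Finset.sum_div]
    have : ∀ x, max (p x - θ) 0 = p x - min θ (p x) := by
      intro x
      rcases le_total θ (p x) with h | h
      · rw [max_eq_left (by linarith), min_eq_left h]
      · rw [max_eq_right (by linarith), min_eq_right h, sub_self]
    simp only [this, Finset.sum_sub_distrib, hsum, sum_min_eq hσ hθ0.le]
    rw [div_eq_one_iff_eq hc.ne']
    ring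
  · intro x; rw [hX, div_mul_cancel₀ _ hc.ne']
  · intro x y
    rw [optimalFinal]
    by_cases hx : optimalX p σ W x = 0
    · rw [hx, zero_mul, zero_mul]
    · congr 1
      rw [optimalCond]
      split_ifs with h1 h2
      · exact hfano0
      -- The swapped value is `θ` at both ranks, as `x` lies in the support and `y` has rank `0`.
      · have hx0 : σ x ≠ 0 := fun h => h1 (σ.injective (h2.trans h.symm))
        rw [hfano _ hx0, sortDesc_eq hσ, min_eq_left (hsupp x hx), min_eq_left]
        rw [← sortDesc_eq hσ y, h2]
        exact hθ0.le
      · rw [hfano _ h2, sortDesc_eq hσ]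

theorem exists_isFillCoupling_optimalFinal (hpos : ∀ y, 0 ≤ p y) (hsum : ∑ y, p y = 1)
    (hσ : Antitone fun k => p (σ.symm k)) {I : ℝ} (hI : I ∈ Icc 0 (shannon p)) :
    ∃ θ, IsFillCoupling p θ (minWasserstein p I) (optimalX p σ (minWasserstein p I))
      (optimalFinal p σ (minWasserstein p I)) ∧
      condEntropy (optimalFinal p σ (minWasserstein p I)) = I := by
  have hd := isDescending_sortDesc hpos hsum
  obtain ⟨θ, hθ, hW, hS⟩ := exists_level_minWasserstein hd hI
  rw [hW]
  rcases (fillMass_le hd θ).lt_or_eq with hlt | heq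
  · have h := isFillCoupling_optimalFinal_of_lt hpos hsum hσ hθ.1 hlt
    exact ⟨θ, h, by rw [h.condEntropy_eq, ← shannon_waterFill_eq hσ hθ.2, hS]⟩
  · have h := isFillCoupling_optimalFinal_top hpos hsum hσ
    rw [heq]
    refine ⟨_, h, ?_⟩
    -- The level need not be unique at the end point, but the distribution is, since `fanoDist`
    -- depends only on the mass.
    have hw : waterFill (sortDesc p) θ = waterFill (sortDesc p) (sortDesc p 0) := by
      rw [← fanoDist_fillMass hd, ← fanoDist_fillMass hd, heq, fillMass_top hd]
    rw [h.condEntropy_eq, ← hS, hw, shannon_waterFill_eq hσ le_rfl, fillMass_top hd]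

end OptimalFinal

/-! ### Transport from the error-free distribution -/

/-- The plan that moves probability from `(y, y)` directly to its destination. -/
def directPlan {n : ℕ} (q : Fin n → Fin n → ℝ) (y x u : Fin n) : ℝ := if u = y then q x y else 0

section Transport

variable {n : ℕ} {N : Fin n → SimpleGraph (Fin n)} {pY : Fin n → ℝ} {q : Fin n → Fin n → ℝ}

/-- For each `y` all the initial mass sits at `(y, y)`, so the targets determine the plan. Every
optimal plan is therefore this one, whatever the costs. -/
theorem isTransportPlan_iff (hq : ∀ x y, 0 ≤ q x y) (hY : marginalY q = pY)
    {π : Fin n → Fin n → Fin n → ℝ} :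
    IsTransportPlan (initialDist pY) q π ↔ π = directPlan q := by
  constructor
  · intro h
    have hz : ∀ y x u, u ≠ y → π y x u = 0 := by
      intro y x u huy
      have := h.source y u
      rw [initialDist, if_neg huy,
        Finset.sum_eq_zero_iff_of_nonneg fun x _ => h.nonneg y x u] at this
      exact this x (Finset.mem_univ x)
    ext y x u
    rw [directPlan]
    split_ifs with huy
    · rw [← h.target y x, Finset.sum_eq_single y (fun v _ hv => hz y x v hv) (by simp), huy]
    · exact hz y x u huy
  · rintro rfl
    refine ⟨fun y x u => ?_, fun y u => ?_, fun y x => by simp [directPlan]⟩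
    · rw [directPlan]
      split_ifs
      exacts [hq x y, le_rfl]
    · simp only [directPlan, initialDist]
      split_ifs with huy
      · rw [← hY]; rfl
      · simp

theorem wasserstein_initialDist (hq : ∀ x y, 0 ≤ q x y) (hY : marginalY q = pY) :
    wasserstein N (initialDist pY) q = transportCost N (directPlan q) := by
  have : {π | IsTransportPlan (initialDist pY) q π} = {directPlan q} := by
    ext π; exact isTransportPlan_iff hq hY
  rw [wasserstein, this, iInf_singleton]

/-- Direct transitions make every move off the diagonal cost exactly `1`, so the cost is the error
probability. -/
theorem transportCost_directPlan (hadj : ∀ y x, x ≠ y → (N y).Adj y x)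
    (hq : ∀ x y, 0 ≤ q x y) :
    transportCost N (directPlan q) =
      ENNReal.ofReal (∑ y, marginalY q y - ∑ y, q y y) := by
  have hw : ∀ y, marginalY q y - q y y = ∑ x, if x = y then 0 else q x y := by
    intro y
    have : ∀ x, (if x = y then 0 else q x y) = q x y - if x = y then q x y else 0 := fun x => by
      split_ifs <;> ring
    simp only [this, Finset.sum_sub_distrib, Finset.sum_ite_eq', Finset.mem_univ, if_true,
      marginalY]
  have hterm : ∀ y x, 0 ≤ (if x = y then 0 else q x y) := fun y x => by
    split_ifs
    exacts [le_rfl, hq x y]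
  rw [← Finset.sum_sub_distrib, Finset.sum_congr rfl fun y _ => hw y,
    ENNReal.ofReal_sum_of_nonneg fun y _ => Finset.sum_nonneg fun x _ => hterm y x, transportCost]
  refine Finset.sum_congr rfl fun y _ => ?_
  rw [ENNReal.ofReal_sum_of_nonneg fun x _ => hterm y x]
  refine Finset.sum_congr rfl fun x _ => ?_
  rw [Finset.sum_eq_single y (fun u _ hu => by simp [directPlan, hu]) (by simp), directPlan,
    if_pos rfl]
  split_ifs with hxy
  · simp [hxy]
  · rw [SimpleGraph.edist_eq_one_iff_adj.2 (hadj y x hxy)]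
    simp

end Transport

/-! ### Constant protocols -/

theorem sub_eq_tanh_half_mul_add {a b F : ℝ} (hb : 0 < b) (ha : 0 < a) (h : Real.log (a / b) = F) :
    a - b = Real.tanh (F / 2) * (a + b) := by
  have hab : a = Real.exp F * b := by
    rw [← h, Real.exp_log (div_pos ha hb), div_mul_cancel₀ _ hb.ne']
  have he : Real.exp F = Real.exp (F / 2) * Real.exp (F / 2) := by
    rw [← Real.exp_add]; congr 1; ring
  have hp := Real.exp_pos (F / 2)
  rw [Real.tanh_eq, hab, he, Real.exp_neg]
  field_simp

namespace FeedbackProcess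

variable {n : ℕ} {N : Fin n → SimpleGraph (Fin n)} {pY : Fin n → ℝ} {τ : ℝ}
  {P : FeedbackProcess N pY τ} {q : Fin n → Fin n → ℝ} {J A : ℝ}

/-- The plan prescribes the force only for transitions leaving `(y, y)`; antisymmetry gives the
reversed ones, and all others carry no jumps. This is the pointwise equality case of the tangent
bound. -/
theorem ae_outSign_mul_current (hq : ∀ x y, 0 ≤ q x y)
    (hP : IsConstantProtocol P (directPlan q) J A) :
    ∃ F, ∀ᵐ t, t ∈ Ioo 0 τ → ∀ y x u,
      P.current t y x u * P.force t y x u = F * (outSign y x u * P.current t y x u) ∧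
      outSign y x u * P.current t y x u =
        Real.tanh (F / 2) * (P.jump t y x u + P.jump t y u x) := by
  obtain ⟨F, hF⟩ := hP.force_const
  refine ⟨F, ?_⟩
  filter_upwards [P.ae_jump_pos_symm] with t ht hmem
  have hout : ∀ y x, x ≠ y → P.current t y x y * P.force t y x y = F * P.current t y x y ∧
      P.current t y x y = Real.tanh (F / 2) * (P.jump t y x y + P.jump t y y x) := by
    intro y x hxy
    have hzero : P.jump t y x y = 0 → P.jump t y y x = 0 →
        P.current t y x y * P.force t y x y = F * P.current t y x y ∧
        P.current t y x y = Real.tanh (F / 2) * (P.jump t y x y + P.jump t y y x) := by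
      intro h1 h2
      simp [current, h1, h2]
    have hsymm : ∀ x u, 0 < P.jump t y x u → 0 < P.jump t y u x := fun x u h => by
      obtain ⟨h1, h2, h3, h4⟩ := ht hmem _ _ _ h
      exact mul_pos h2 h4
    rcases (hq x y).eq_or_lt with h0 | h0
    · have h1 : directPlan q y x y = 0 := by rw [directPlan, if_pos rfl, ← h0]
      have h2 : directPlan q y y x = 0 := by rw [directPlan, if_neg hxy]
      exact hzero (hP.off_plan t hmem y x y hxy h1 h2) (hP.off_plan t hmem y y x hxy.symm h2 h1)
    rcases (P.jump_nonneg hmem y x y).eq_or_lt with hj | hj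
    · refine hzero hj.symm ?_
      rcases (P.jump_nonneg hmem y y x).eq_or_lt with hj' | hj'
      · exact hj'.symm
      · exact absurd (hsymm _ _ hj') (by rw [← hj]; exact lt_irrefl 0)
    · have hj' := hsymm _ _ hj
      have hf := hF t hmem y x y hxy (by rwa [directPlan, if_pos rfl]) (by positivity)
      exact ⟨by rw [hf, mul_comm], sub_eq_tanh_half_mul_add hj' hj hf⟩
  intro y x u
  rcases eq_or_ne x u with rfl | hxu
  · simp [outSign, P.jump_self hmem, current]
  rcases eq_or_ne u y with rfl | huy
  · have := hout u x hxu
    simpa [outSign, hxu] using this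
  rcases eq_or_ne x y with rfl | hxy
  · have := hout x u huy
    rw [P.current_swap t x u x, P.force_swap t x u x] at *
    simp only [outSign, huy, if_false, if_true]
    rw [add_comm]
    constructor <;> linarith [this.1, this.2]
  · have h1 := hP.off_plan t hmem y x u hxu (by simp [directPlan, huy]) (by simp [directPlan, hxy])
    have h2 := hP.off_plan t hmem y u x hxu.symm (by simp [directPlan, hxy])
      (by simp [directPlan, huy])
    simp [current, h1, h2]

/-- Constant protocols attain the minimal entropy production at given activity. -/
theorem totalProduction_eq_of_isConstantProtocol (hτ : 0 < τ) (hsum : ∑ y, pY y = 1)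
    (hq : ∀ x y, 0 ≤ q x y) (hP : IsConstantProtocol P (directPlan q) J A) {W : ℝ}
    (hW : 1 - ∑ y, P.prob τ y y = W) :
    P.totalProduction = 2 * W * Real.artanh (W / (τ * P.meanActivity)) := by
  obtain ⟨F, hF⟩ := ae_outSign_mul_current hq hP
  have hJ := P.intervalIntegrable_current
  have hj := P.intervalIntegrable_jump
  have hF' := ae_restrict_of_Ioo hτ hF
  have hi : ∀ y x u, IntervalIntegrable (fun t => P.current t y x u * P.force t y x u)
      volume 0 τ := by
    intro y x u
    refine (((hJ y x u).const_mul (outSign y x u)).const_mul F).congr_ae ?_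
    rw [EventuallyEq, ae_restrict_iff' measurableSet_uIoc]
    filter_upwards [hF'] with t ht hmem
    exact (ht hmem y x u).1.symm
  have hprod : P.totalProduction = F * W := by
    rw [P.totalProduction_eq hτ hi, ← hW, P.error_eq_outflow hτ hsum, Finset.mul_sum,
      Finset.mul_sum]
    refine Finset.sum_congr rfl fun y _ => ?_
    have : ∀ x u, ∫ t in (0 : ℝ)..τ, P.current t y x u * P.force t y x u =
        F * (outSign y x u * ∫ t in (0 : ℝ)..τ, P.current t y x u) := by
      intro x u
      rw [← intervalIntegral.integral_const_mul, ← intervalIntegral.integral_const_mul]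
      refine intervalIntegral.integral_congr_ae ?_
      filter_upwards [hF'] with t ht hmem
      exact (ht hmem y x u).1
    simp only [this, ← Finset.mul_sum, P.sum_outSign_mul_integral_current]
    ring
  have hT : τ * P.meanActivity = ∫ t in (0 : ℝ)..τ, P.activity t := by
    rw [meanActivity]; field_simp
  -- Together with production `F * W` this identifies `F` as `2 artanh (W / T)`, unless `T = 0`,
  -- where `W = 0` as well.
  have htanh : W = Real.tanh (F / 2) * (τ * P.meanActivity) := by
    rw [hT, P.integral_activity_eq hτ, ← hW, P.error_eq_outflow hτ hsum, Finset.mul_sum]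
    refine Finset.sum_congr rfl fun y _ => ?_
    have h1 := P.sum_outSign_mul_integral_current y
    have : ∀ x u, outSign y x u * ∫ t in (0 : ℝ)..τ, P.current t y x u =
        Real.tanh (F / 2) * ((∫ t in (0 : ℝ)..τ, P.jump t y x u) +
          ∫ t in (0 : ℝ)..τ, P.jump t y u x) := by
      intro x u
      rw [← intervalIntegral.integral_const_mul, ← intervalIntegral.integral_add (hj y x u)
        (hj y u x), ← intervalIntegral.integral_const_mul]
      refine intervalIntegral.integral_congr_ae ?_
      filter_upwards [hF'] with t ht hmem
      exact (ht hmem y x u).2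
    simp only [this, ← Finset.mul_sum] at h1
    have h2 := sum_sum_eq_half_sum_add_swap (fun x u => ∫ t in (0 : ℝ)..τ, P.jump t y x u)
    rw [h2]
    linarith
  rw [hprod]
  by_cases h0 : τ * P.meanActivity = 0
  · rw [h0, mul_zero] at htanh
    rw [htanh]; ring
  · have : W / (τ * P.meanActivity) = Real.tanh (F / 2) := by
      rw [div_eq_iff h0]; exact htanh
    rw [this, Real.artanh_tanh]
    ring

end FeedbackProcess

/-! ### An explicit protocol with constant currents and force -/

section DirectProcess

variable {n : ℕ} {N : Fin n → SimpleGraph (Fin n)} {pY : Fin n → ℝ} {q : Fin n → Fin n → ℝ} {τ : ℝ}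

/-- The part of `q` off the diagonal. -/
def offDiag (q : Fin n → Fin n → ℝ) (x y : Fin n) : ℝ := if x = y then 0 else q x y

/-- Jump frequencies, constant in time, that carry `q x y` from `(y, y)` to `(x, y)` within the
time `τ`; `k` is the ratio of the backward jump frequency to the transported probability. -/
def directJump (q : Fin n → Fin n → ℝ) (τ k : ℝ) (y x u : Fin n) : ℝ :=
  if u = y then offDiag q x y * (k + 1 / τ) else if x = y then offDiag q u y * k else 0

/-- Linear interpolation between the error-free distribution and `q`. -/
def directProb (pY : Fin n → ℝ) (q : Fin n → Fin n → ℝ) (τ t : ℝ) (x y : Fin n) : ℝ :=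
  (1 - t / τ) * initialDist pY x y + t / τ * q x y

theorem offDiag_self (q : Fin n → Fin n → ℝ) (y : Fin n) : offDiag q y y = 0 := if_pos rfl

theorem directJump_sub (q : Fin n → Fin n → ℝ) (τ k : ℝ) (y x u : Fin n) :
    directJump q τ k y x u - directJump q τ k y u x =
      (if u = y then offDiag q x y / τ else 0) - (if x = y then offDiag q u y / τ else 0) := by
  unfold directJump
  by_cases h1 : u = y <;> by_cases h2 : x = y
  · subst h1; subst h2; simp [offDiag_self]
  · simp only [h1, h2, if_true, if_false]; ring
  · simp only [h1, h2, if_true, if_false]; ring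
  · simp [h1, h2]

variable (hq : ∀ x y, 0 ≤ q x y) (hY : marginalY q = pY) (hτ : 0 < τ)

include hq in
theorem offDiag_nonneg (x y : Fin n) : 0 ≤ offDiag q x y := by
  unfold offDiag
  split_ifs
  exacts [le_rfl, hq x y]

include hq hY in
theorem le_of_marginalY_eq (x y : Fin n) : q x y ≤ pY y := by
  rw [← hY]
  exact Finset.single_le_sum (f := fun x => q x y) (fun x _ => hq x y) (Finset.mem_univ x)

include hq hτ in
theorem directJump_nonneg {k : ℝ} (hk : 0 < k) (y x u : Fin n) : 0 ≤ directJump q τ k y x u := by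
  have := offDiag_nonneg hq
  unfold directJump
  split_ifs
  · exact mul_nonneg (this x y) (by positivity)
  · exact mul_nonneg (this u y) hk.le
  · exact le_rfl

include hτ in
theorem directJump_pos_symm {k : ℝ} (hk : 0 < k) {y x u : Fin n}
    (h : 0 < directJump q τ k y x u) : 0 < directJump q τ k y u x := by
  have hk' : 0 < k + 1 / τ := by positivity
  unfold directJump at h ⊢
  by_cases h1 : u = y <;> by_cases h2 : x = y
  · subst h1; subst h2; simp [offDiag_self] at h
  · simp only [h1, h2, if_true, if_false] at h ⊢
    exact mul_pos (pos_of_mul_pos_left h hk'.le) hk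
  · simp only [h1, h2, if_true, if_false] at h ⊢
    exact mul_pos (pos_of_mul_pos_left h hk.le) hk'
  · simp [h1, h2] at h

include hq hY in
theorem directProb_nonneg {t : ℝ} (ht : t ∈ Icc 0 τ) (x y : Fin n) :
    0 ≤ directProb pY q τ t x y := by
  have h1 : 0 ≤ t / τ := div_nonneg ht.1 (ht.1.trans ht.2)
  have h2 : t / τ ≤ 1 := div_le_one_of_le₀ ht.2 (ht.1.trans ht.2)
  refine add_nonneg (mul_nonneg (by linarith) ?_) (mul_nonneg h1 (hq x y))
  unfold initialDist
  split_ifs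
  exacts [(hq x y).trans (le_of_marginalY_eq hq hY x y), le_rfl]

include hq hY hτ in
-- Justifies dividing jump frequencies by probabilities to obtain rates: at interior times both ends
-- of the interpolation have positive weight, and a source of jumps has positive mass at one of
-- them.
theorem directProb_pos {k t : ℝ} (hk : 0 < k) (ht : t ∈ Ioo 0 τ) {y x u : Fin n}
    (h : 0 < directJump q τ k y x u) : 0 < directProb pY q τ t u y := by
  have h1 : 0 < t / τ := div_pos ht.1 hτ
  have h2 : t / τ < 1 := (div_lt_one hτ).2 ht.2
  have hk' : 0 < k + 1 / τ := by positivity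
  unfold directJump at h
  unfold directProb initialDist
  split_ifs at h ⊢ with hu hx
  · have hpos := pos_of_mul_pos_left h hk'.le
    have : 0 < pY y := by
      unfold offDiag at hpos
      split_ifs at hpos with hxy
      · exact absurd hpos (lt_irrefl 0)
      · exact hpos.trans_le (le_of_marginalY_eq hq hY x y)
    have := hq u y
    have h3 : 0 < 1 - t / τ := by linarith
    positivity
  · have hpos := pos_of_mul_pos_left h hk.le
    rw [offDiag, if_neg hu] at hpos
    positivity
  · exact absurd h (lt_irrefl 0)

include hq hY hτ in
theorem directJump_div_mul {k t : ℝ} (hk : 0 < k) (ht : t ∈ Ioo 0 τ) (y x u : Fin n) :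
    directJump q τ k y x u / directProb pY q τ t u y * directProb pY q τ t u y =
      directJump q τ k y x u := by
  rcases (directJump_nonneg hq hτ hk y x u).eq_or_lt with h | h
  · rw [← h]; simp
  · exact div_mul_cancel₀ _ (directProb_pos hq hY hτ hk ht h).ne'

/-- Rates may diverge at an end point where a probability vanishes; the heat stays finite because
the logarithm of an affine function of time is integrable. -/
theorem intervalIntegrable_log_directProb (x y : Fin n) :
    IntervalIntegrable (fun t => Real.log (directProb pY q τ t x y)) volume 0 τ := by
  refine MeromorphicOn.intervalIntegrable_log (f := fun t => directProb pY q τ t x y) ?_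
  intro t _
  have : AnalyticAt ℝ (fun t : ℝ => directProb pY q τ t x y) t := by
    unfold directProb
    simp only [div_eq_mul_inv]
    fun_prop
  exact this.meromorphicAt

theorem intervalIntegrable_congr_Ioo {f g : ℝ → ℝ} (hτ : 0 < τ)
    (hf : IntervalIntegrable f volume 0 τ) (h : ∀ t ∈ Ioo 0 τ, f t = g t) :
    IntervalIntegrable g volume 0 τ := by
  refine hf.congr_ae ?_
  rw [EventuallyEq, ae_restrict_iff' measurableSet_uIoc]
  exact FeedbackProcess.ae_restrict_of_Ioo hτ (ae_of_all _ h)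

theorem intervalIntegral_congr_Ioo {f g : ℝ → ℝ} {t : ℝ} (ht : t ∈ Icc 0 τ)
    (h : ∀ s ∈ Ioo 0 τ, f s = g s) : ∫ s in (0 : ℝ)..t, f s = ∫ s in (0 : ℝ)..t, g s := by
  rcases ht.1.eq_or_lt with rfl | h0
  · simp
  · exact intervalIntegral.integral_congr_ae (FeedbackProcess.ae_restrict_of_Ioo h0
      (ae_of_all _ fun s hs => h s ⟨hs.1, hs.2.trans_le ht.2⟩))

include hY in
theorem sum_directJump_sub (τ k : ℝ) (x y : Fin n) :
    ∑ u, (directJump q τ k y x u - directJump q τ k y u x) = (q x y - initialDist pY x y) / τ := by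
  simp only [directJump_sub, Finset.sum_sub_distrib, Finset.sum_ite_eq', Finset.mem_univ, if_true]
  unfold initialDist
  by_cases hxy : x = y
  · subst hxy
    have hs : ∑ u, offDiag q u x = pY x - q x x := by
      have : ∀ u, offDiag q u x = q u x - if u = x then q u x else 0 := fun u => by
        unfold offDiag; split_ifs <;> ring
      simp only [this, Finset.sum_sub_distrib, Finset.sum_ite_eq', Finset.mem_univ, if_true,
        ← hY, marginalY]
    simp only [offDiag_self, if_true, ← Finset.sum_div, hs]
    ring
  · simp [hxy, offDiag]

/-- The process that carries probability directly from `(y, y)` to its destination, with constant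
currents and a constant force. -/
def directProcess (hadj : ∀ y x, x ≠ y → (N y).Adj y x) (hq : ∀ x y, 0 ≤ q x y)
    (hY : marginalY q = pY) (hτ : 0 < τ) {k : ℝ} (hk : 0 < k) : FeedbackProcess N pY τ where
  rate t y x u := directJump q τ k y x u / directProb pY q τ t u y
  prob t x y := directProb pY q τ t x y
  rate_nonneg t ht y x u := div_nonneg (directJump_nonneg hq hτ hk y x u)
    (directProb_nonneg hq hY (Ioo_subset_Icc_self ht) u y)
  rate_eq_zero t _ y x u hna := by
    have : directJump q τ k y x u = 0 := by
      unfold directJump offDiag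
      split_ifs with h1 h2 h2
      · simp
      · subst h1; exact absurd (hadj _ _ h2) hna
      · subst h2; exact absurd (hadj _ _ h1).symm hna
      · rfl
    rw [this, zero_div]
  rate_pos_symm t ht y x u h := by
    have hj : 0 < directJump q τ k y x u :=
      (directJump_nonneg hq hτ hk y x u).lt_of_ne' (left_ne_zero_of_mul h.ne')
    have hj' := directJump_pos_symm hτ hk hj
    exact div_pos hj' (directProb_pos hq hY hτ hk ht hj')
  prob_nonneg t ht x y := directProb_nonneg hq hY ht x y
  prob_zero := by ext x y; simp [directProb]
  jump_integrable y x u :=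
    intervalIntegrable_congr_Ioo hτ (intervalIntegrable_const (c := directJump q τ k y x u))
      fun t ht => (directJump_div_mul hq hY hτ hk ht y x u).symm
  master t ht x y := by
    rw [intervalIntegral_congr_Ioo ht (g := fun _ => (q x y - initialDist pY x y) / τ)]
    · rw [intervalIntegral.integral_const, directProb, directProb, smul_eq_mul]
      ring
    · intro s hs
      rw [← sum_directJump_sub hY τ k x y]
      exact Finset.sum_congr rfl fun u _ => by
        rw [directJump_div_mul hq hY hτ hk hs, directJump_div_mul hq hY hτ hk hs]
  heat_integrable y x u := by
    set a := directJump q τ k y x u with ha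
    set b := directJump q τ k y u x with hb
    refine intervalIntegrable_congr_Ioo hτ (f := fun t => (Real.log (a / b) +
      (Real.log (directProb pY q τ t x y) - Real.log (directProb pY q τ t u y))) * a)
      (((intervalIntegrable_const).add ((intervalIntegrable_log_directProb x y).sub
        (intervalIntegrable_log_directProb u y))).mul_const a) fun t ht => ?_
    rw [ha, directJump_div_mul hq hY hτ hk ht, ← ha]
    rcases (directJump_nonneg hq hτ hk y x u).eq_or_lt with h | h
    · rw [ha, ← h]; simp
    · have h' := directJump_pos_symm hτ hk h
      have h1 := directProb_pos hq hY hτ hk ht h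
      have h2 := directProb_pos hq hY hτ hk ht h'
      rw [← ha] at h
      rw [← hb] at h'
      rw [div_div_div_eq, Real.log_div h.ne' h'.ne', Real.log_div (by positivity) (by positivity),
        Real.log_mul h.ne' h2.ne', Real.log_mul h1.ne' h'.ne']
      ring

variable (hadj : ∀ y x, x ≠ y → (N y).Adj y x) {k : ℝ} (hk : 0 < k)

theorem directProcess_prob_final :
    (directProcess hadj hq hY hτ hk).prob τ = q := by
  ext x y
  change directProb pY q τ τ x y = q x y
  rw [directProb, div_self hτ.ne']
  ring

theorem directProcess_jump {t : ℝ} (ht : t ∈ Ioo 0 τ) (y x u : Fin n) :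
    (directProcess hadj hq hY hτ hk).jump t y x u = directJump q τ k y x u :=
  directJump_div_mul hq hY hτ hk ht y x u

theorem directProcess_current {t : ℝ} (ht : t ∈ Ioo 0 τ) (y x u : Fin n) :
    (directProcess hadj hq hY hτ hk).current t y x u =
      (if u = y then offDiag q x y / τ else 0) - (if x = y then offDiag q u y / τ else 0) := by
  rw [FeedbackProcess.current, directProcess_jump hq hY hτ hadj hk ht,
    directProcess_jump hq hY hτ hadj hk ht, directJump_sub]

theorem directProcess_activity {t : ℝ} (ht : t ∈ Ioo 0 τ) :
    (directProcess hadj hq hY hτ hk).activity t =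
      (∑ y, ∑ x, offDiag q x y) * (2 * k + 1 / τ) := by
  rw [FeedbackProcess.activity_eq _ ht, Finset.sum_mul]
  refine Finset.sum_congr rfl fun y _ => ?_
  simp only [directProcess_jump hq hY hτ hadj hk ht]
  have : ∀ x u, directJump q τ k y x u = (if u = y then offDiag q x y * (k + 1 / τ) else 0) +
      (if x = y then offDiag q u y * k else 0) := by
    intro x u
    unfold directJump
    by_cases h1 : u = y
    · subst h1; simp [offDiag_self]
    · simp [h1]
  simp only [this, Finset.sum_add_distrib, Finset.sum_ite_eq', Finset.mem_univ, if_true]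
  rw [Finset.sum_comm (f := fun x u => if x = y then offDiag q u y * k else 0)]
  simp only [Finset.sum_ite_eq', Finset.mem_univ, if_true, ← Finset.sum_mul]
  ring

theorem isConstantProtocol_directProcess :
    IsConstantProtocol (directProcess hadj hq hY hτ hk) (directPlan q)
      ((∑ y, ∑ x, offDiag q x y) / τ) ((∑ y, ∑ x, offDiag q x y) * (2 * k + 1 / τ)) where
  transport y x u hxu := by
    rw [intervalIntegral_congr_Ioo ⟨hτ.le, le_rfl⟩ fun t ht =>
      directProcess_current hq hY hτ hadj hk ht y x u, intervalIntegral.integral_const, sub_zero,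
      smul_eq_mul, directPlan, directPlan]
    by_cases h1 : u = y <;> by_cases h2 : x = y
    · exact absurd (h2.trans h1.symm) hxu
    · simp only [h1, h2, if_true, if_false, offDiag]
      field_simp
      ring
    · simp only [h1, h2, if_true, if_false, offDiag]
      field_simp
      ring
    · simp [h1, h2]
  off_plan t ht y x u hxu h1 h2 := by
    rw [directProcess_jump hq hY hτ hadj hk ht]
    unfold directPlan at h1 h2
    unfold directJump offDiag
    split_ifs at * <;> simp_all
  current_const t ht := by
    rw [Finset.sum_div]
    refine Finset.sum_congr rfl fun y _ => ?_
    rw [Finset.sum_div]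
    refine Finset.sum_congr rfl fun x _ => ?_
    rw [Finset.sum_eq_single y ?_ (by simp)]
    · rw [directProcess_current hq hY hτ hadj hk ht, directPlan, if_pos rfl, if_pos rfl]
      by_cases hxy : x = y
      · subst hxy; simp [offDiag_self]
      · have := hq x y
        simp only [hxy, offDiag, ne_eq, not_false_eq_true, true_and, if_false, sub_zero]
        split_ifs with h
        · rfl
        · rw [le_antisymm (not_lt.1 h) this, zero_div]
    · intro u _ hu
      rw [if_neg]
      simp [directPlan, hu]
  activity_const t ht := directProcess_activity hq hY hτ hadj hk ht
  force_const := by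
    -- The transported probability is a common factor of both jump frequencies and cancels in their
    -- ratio.
    refine ⟨Real.log ((k + 1 / τ) / k), fun t ht y x u hxu hπ _ => ?_⟩
    unfold directPlan at hπ
    split_ifs at hπ with hu
    · subst hu
      rw [FeedbackProcess.force, directProcess_jump hq hY hτ hadj hk ht,
        directProcess_jump hq hY hτ hadj hk ht, directJump, directJump, if_pos rfl, if_neg hxu,
        if_pos rfl, offDiag, if_neg hxu, mul_div_mul_left _ _ hπ.ne']
    · exact absurd hπ (lt_irrefl 0)

theorem sum_offDiag (q : Fin n → Fin n → ℝ) :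
    ∑ y, ∑ x, offDiag q x y = ∑ y, marginalY q y - ∑ y, q y y := by
  rw [← Finset.sum_sub_distrib]
  refine Finset.sum_congr rfl fun y _ => ?_
  have : ∀ x, offDiag q x y = q x y - if x = y then q x y else 0 := fun x => by
    unfold offDiag; split_ifs <;> ring
  simp only [this, Finset.sum_sub_distrib, Finset.sum_ite_eq', Finset.mem_univ, if_true, marginalY]

end DirectProcess

theorem IsConstantProtocol.meanActivity_eq {n : ℕ} {N : Fin n → SimpleGraph (Fin n)}
    {pY : Fin n → ℝ} {τ : ℝ} {P : FeedbackProcess N pY τ} {π : Fin n → Fin n → Fin n → ℝ}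
    {J A : ℝ} (h : IsConstantProtocol P π J A) (hτ : 0 < τ) : P.meanActivity = A := by
  rw [FeedbackProcess.meanActivity, intervalIntegral_congr_Ioo ⟨hτ.le, le_rfl⟩ h.activity_const,
    intervalIntegral.integral_const, sub_zero, smul_eq_mul, mul_div_cancel_left₀ _ hτ.ne']

end

end Feedback

/-! ### Assembly of the main theorem -/

open Set Feedback in
theorem mainTheorem3 {n : ℕ} [NeZero n] (N : Fin n → SimpleGraph (Fin n)) (pY : Fin n → ℝ)
    (hpos : ∀ y, 0 ≤ pY y) (hsum : ∑ y, pY y = 1) (β : ℝ) (hβ : 0 < β) (τ : ℝ) (hτ : 0 < τ) :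
    -- `minWasserstein pY` is a genuine inverse function
    BijOn (fun W => shannon (fanoDist pY W)) (Icc 0 (1 - sortDesc pY 0)) (Icc 0 (shannon pY)) ∧
    -- the speed limit
    (∀ P : FeedbackProcess N pY τ,
      |P.infoChange| ≤ shannon pY ∧
      minWasserstein pY |P.infoChange| / (τ * P.meanActivity) ∈ Ico 0 1 ∧
      activityBound pY τ P.meanActivity |P.infoChange| ≤ P.entropyProduction β) ∧
    -- attainment, under the condition that all direct transitions out of `x = y` are allowed
    ((∀ y x, x ≠ y → (N y).Adj y x) →
      ∀ σ : Equiv.Perm (Fin n), Antitone (fun k => pY (σ.symm k)) →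
      ∀ I ∈ Icc 0 (shannon pY), ∀ W : ℝ, W = minWasserstein pY I →
        -- the optimal final distribution is admissible, at distance `W` and consumes `I`
        (∀ x y, 0 ≤ optimalFinal pY σ W x y) ∧
        marginalY (optimalFinal pY σ W) = pY ∧
        wasserstein N (initialDist pY) (optimalFinal pY σ W) = ENNReal.ofReal W ∧
        |mutualInfo (optimalFinal pY σ W) - mutualInfo (initialDist pY)| = I ∧
        -- every constant protocol along an optimal plan attains equality
        (∀ (P : FeedbackProcess N pY τ) (π : Fin n → Fin n → Fin n → ℝ) (J A : ℝ),
          P.prob τ = optimalFinal pY σ W →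
          IsOptimalPlan N (initialDist pY) (optimalFinal pY σ W) π →
          IsConstantProtocol P π J A →
          P.entropyProduction β = activityBound pY τ P.meanActivity |P.infoChange|) ∧
        -- such a protocol exists for every admissible value of the activity
        (∀ A : ℝ, (0 < I ∧ W < τ * A) ∨ (I = 0 ∧ A = 0) →
          ∃ (P : FeedbackProcess N pY τ) (π : Fin n → Fin n → Fin n → ℝ),
            P.prob τ = optimalFinal pY σ W ∧
            IsOptimalPlan N (initialDist pY) (optimalFinal pY σ W) π ∧
            IsConstantProtocol P π (W / τ) A ∧
            P.meanActivity = A ∧ |P.infoChange| = I ∧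
            P.entropyProduction β = activityBound pY τ A I)) := by
  have hd := isDescending_sortDesc hpos hsum
  refine ⟨bijOn_shannon_fanoDist hd, fun P => P.activity_speed_limit hpos hsum hτ hβ, ?_⟩
  rintro hadj σ hσ I hI W rfl
  set W := minWasserstein pY I with hW
  set q := optimalFinal pY σ W with hq_def
  obtain ⟨θ, hfill, hent⟩ := exists_isFillCoupling_optimalFinal hpos hsum hσ hI
  rw [← hW, ← hq_def] at hfill hent
  have hq := hfill.coupling_nonneg
  have hY := hfill.marginalY_eq
  have hoff : ∑ y, marginalY q y - ∑ y, q y y = W := by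
    rw [hY, hsum, hfill.sum_diag]; ring
  have hwass : wasserstein N (initialDist pY) q = ENNReal.ofReal W := by
    rw [wasserstein_initialDist hq hY, transportCost_directPlan hadj hq, hoff]
  have hattain : ∀ (P : FeedbackProcess N pY τ) (π : Fin n → Fin n → Fin n → ℝ) (J A : ℝ),
      P.prob τ = q → IsOptimalPlan N (initialDist pY) q π → IsConstantProtocol P π J A →
      |P.infoChange| = I ∧
        P.entropyProduction β = activityBound pY τ P.meanActivity |P.infoChange| := by
    intro P π J A hP hπ hc
    rw [(isTransportPlan_iff hq hY).1 hπ.isPlan] at hc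
    obtain ⟨h1, h2⟩ := P.condEntropy_eq hτ
    rw [hP, hent] at h1 h2
    refine ⟨h2, ?_⟩
    have h3 : 1 - ∑ y, P.prob τ y y = W := by rw [hP, hfill.sum_diag]; ring
    rw [P.entropyProduction_eq hτ hβ,
      FeedbackProcess.totalProduction_eq_of_isConstantProtocol hτ hsum hq hc h3, h2, h1,
      activityBound]
    ring
  refine ⟨hq, hY, hwass, ?_, fun P π J A hP hπ hc => (hattain P π J A hP hπ hc).2, ?_⟩
  · rw [abs_mutualInfo_sub_initialDist hq hY, hent]
  intro A hA
  have hW0 : 0 ≤ W := ((bijOn_shannon_fanoDist hd).surjOn.mapsTo_invFunOn hI).1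
  -- The free backward ratio `k` tunes the activity without changing the net current; for `W > 0`
  -- its positivity is exactly `W < τ * A`.
  have hk : ∃ k, 0 < k ∧ W * (2 * k + 1 / τ) = A := by
    rcases hA with ⟨hI0, hWA⟩ | ⟨hI0, hA0⟩
    · have hWpos : 0 < W :=
        hW0.lt_of_ne' (mt (minWasserstein_eq_zero_iff hd hI).1 hI0.ne')
      refine ⟨(A / W - 1 / τ) / 2, ?_, ?_⟩
      · have : 1 / τ < A / W := by
          rw [div_lt_div_iff₀ hτ hWpos]; linarith
        linarith
      · field_simp
        ring
    · have hWz : W = 0 := (minWasserstein_eq_zero_iff hd hI).2 hI0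
      -- Nothing is transported, so any positive `k` gives zero activity.
      exact ⟨1, one_pos, by rw [hWz, hA0, zero_mul]⟩
  obtain ⟨k, hk, hkA⟩ := hk
  have hP := directProcess_prob_final hq hY hτ hadj hk
  have hπ : IsOptimalPlan N (initialDist pY) q (directPlan q) :=
    ⟨(isTransportPlan_iff hq hY).2 rfl, (wasserstein_initialDist hq hY).symm⟩
  have hc := isConstantProtocol_directProcess hq hY hτ hadj hk
  rw [sum_offDiag, hoff, hkA] at hc
  have hact := hc.meanActivity_eq hτ
  obtain ⟨h1, h2⟩ := hattain _ _ _ _ hP hπ hc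
  refine ⟨_, _, hP, hπ, hc, hact, h1, ?_⟩
  rw [h2, hact, h1]
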